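/- All codes are binary linear codes, i.e. subspaces $C\subseteq\mathbb F_2^n$; $C^\perp$ is the dual with respect to the standard inner product, and $C$ is self-dual if $C=C^\perp$. The weight of a vector is the number of its non-zero coordinates. A self-dual code is doubly even if all its weights are divisible by $4$, and singly even if it has a codeword of weight $\equiv 2 \pmod 4$. A doubly even self-dual code of length $n$ is extremal if its minimum weight is $4\lfloor n/24\rfloor+4$ (which is $20$ for $n=112$). Two codes are equivalent if one is obtained from the other by permuting the coordinates. Two self-dual codes $C,C'$ of length $n$ are neighbors if $\dim(C\cap C')=n/2-1$. The four-circulant code with first rows $r_A,r_B\in\mathbb F_2^{m}$ is the code of length $4m$ with generator matrix $$\begin{pmatrix} I_{2m} & \begin{matrix} A & B\\ B^T & A^T\end{matrix}\end{pmatrix},$$ where $A$ and $B$ are the $m\times m$ circulant matrices with first rows $r_A$ and $r_B$ (each further row being the previous one shifted cyclically one place to the right). Let $C_{112}$ be the four-circulant code of length $112$ with $r_A=(1000010101101101111011011010)$, $r_B=(0010001110000110001010000001)$. Let $x\in\mathbb F_2^{112}$ be the vector with support $\{1,2,3,9,10,12,13,16,24,61,66,69,82,89,92,96,97,108,111,112\}$,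 and let $D_{112}=\langle\, C_{112}\cap\langle x\rangle^\perp,\ x\,\rangle$. Let $E_{112}$ be the four-circulant code of length $112$ with $r_A=(1000000010001000011111001101)$, $r_B=(0111101000101001110101011110)$. **Proposition.** There are at least three pairwise inequivalent extremal doubly even self-dual codes of length $112$. More precisely: $C_{112}$ is a singly even self-dual code and $D_{112}$ is a neighbor of it; $D_{112}$ and $E_{112}$ are extremal doubly even self-dual codes and are inequivalent; and there is a further extremal doubly even self-dual code $H$ of length $112$ that is equivalent neither to $D_{112}$ nor to $E_{112}$. -/

import Mathlib

/-- A binary (linear) code of length `n`: a subspace of `𝔽₂ⁿ`. -/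
abbrev BinaryCode (n : ℕ) : Type := Submodule (ZMod 2) (Fin n → ZMod 2)

namespace BinaryCode

variable {n : ℕ}

/-- The dual code with respect to the standard inner product. -/
def dual (C : BinaryCode n) : BinaryCode n where
  carrier := {x | ∀ y ∈ C, x ⬝ᵥ y = 0}
  zero_mem' := fun y _ => zero_dotProduct y
  add_mem' := fun {a b} ha hb y hy => by rw [add_dotProduct, ha y hy, hb y hy, add_zero]
  smul_mem' := fun c x hx y hy => by rw [smul_dotProduct, hx y hy, smul_zero]

/-- A code is self-dual if it equals its dual. -/
def IsSelfDual (C : BinaryCode n) : Prop := C = C.dual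

/-- A self-dual code is doubly even if all weights are divisible by four. -/
def IsDoublyEvenSelfDual (C : BinaryCode n) : Prop :=
  C.IsSelfDual ∧ ∀ x ∈ C, 4 ∣ hammingNorm x

/-- A self-dual code is singly even if some codeword has weight congruent to two mod four. -/
def IsSinglyEvenSelfDual (C : BinaryCode n) : Prop :=
  C.IsSelfDual ∧ ∃ x ∈ C, hammingNorm x % 4 = 2

/-- `d` is the minimum weight of `C`: the least weight of a non-zero codeword. -/
def HasMinimumWeight (C : BinaryCode n) (d : ℕ) : Prop :=
  IsLeast {w : ℕ | ∃ x ∈ C, x ≠ 0 ∧ hammingNorm x = w} d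

/-- A doubly even self-dual code is extremal if its minimum weight meets the
Mallows-Sloane bound `4 ⌊n / 24⌋ + 4`. -/
def IsExtremalDoublyEvenSelfDual (C : BinaryCode n) : Prop :=
  C.IsDoublyEvenSelfDual ∧ C.HasMinimumWeight (4 * (n / 24) + 4)

/-- Two codes are equivalent if one is obtained from the other by permuting the coordinates. -/
def Equivalent (C C' : BinaryCode n) : Prop :=
  ∃ σ : Equiv.Perm (Fin n), C' = C.map (LinearMap.funLeft (ZMod 2) (ZMod 2) σ)

/-- Two self-dual codes of length `n` are neighbors if their intersection has
dimension `n / 2 - 1`. -/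
def AreNeighbors (C C' : BinaryCode n) : Prop :=
  C.IsSelfDual ∧ C'.IsSelfDual ∧
    Module.finrank (ZMod 2) (C ⊓ C' : BinaryCode n) = n / 2 - 1

/-- The circulant matrix with first row `r`; each row is the cyclic shift of the previous
row one place to the right. (Mathlib's `Matrix.circulant r` has first *column* `r`.) -/
def rowCirculant {m : ℕ} (r : Fin m → ZMod 2) : Matrix (Fin m) (Fin m) (ZMod 2) :=
  (Matrix.circulant r).transpose

/-- The generator matrix `[ I | A B ; Bᵀ Aᵀ ]`, where `A` and `B` are the circulant matrices
with first rows `a` and `b`. -/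
def fourCirculantGenerator {m : ℕ} (a b : Fin m → ZMod 2) :
    Matrix (Fin m ⊕ Fin m) ((Fin m ⊕ Fin m) ⊕ (Fin m ⊕ Fin m)) (ZMod 2) :=
  Matrix.fromCols 1
    (Matrix.fromBlocks (rowCirculant a) (rowCirculant b)
      (rowCirculant b).transpose (rowCirculant a).transpose)

/-- The left-to-right numbering of the four blocks of `m` columns. -/
def fourBlockEquiv (m : ℕ) :
    (Fin m ⊕ Fin m) ⊕ (Fin m ⊕ Fin m) ≃ Fin ((m + m) + (m + m)) :=
  (Equiv.sumCongr finSumFinEquiv finSumFinEquiv).trans finSumFinEquiv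

/-- The four-circulant code of length `4m` with first rows `a` and `b`: the row space of its
generator matrix. -/
def fourCirculantCode {m : ℕ} (a b : Fin m → ZMod 2) : BinaryCode ((m + m) + (m + m)) :=
  Submodule.span (ZMod 2) (Set.range fun i : Fin m ⊕ Fin m =>
    fun j : Fin ((m + m) + (m + m)) => fourCirculantGenerator a b i ((fourBlockEquiv m).symm j))

/-- The four-circulant code `C₁₁₂`. -/
def C112 : BinaryCode 112 :=
  fourCirculantCode (m := 28)
    ![1,0,0,0,0,1,0,1,0,1,1,0,1,1,0,1,1,1,1,0,1,1,0,1,1,0,1,0]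
    ![0,0,1,0,0,0,1,1,1,0,0,0,0,1,1,0,0,0,1,0,1,0,0,0,0,0,0,1]

/-- The vector `x` defining `D₁₁₂`, given by its support in the coordinates `1, …, 112`. -/
def x112 : Fin 112 → ZMod 2 := fun i =>
  if (i : ℕ) + 1 ∈ ({1, 2, 3, 9, 10, 12, 13, 16, 24, 61, 66, 69, 82, 89, 92, 96, 97, 108,
    111, 112} : Finset ℕ) then 1 else 0

/-- The code `D₁₁₂ = ⟨C₁₁₂ ∩ ⟨x⟩^⊥, x⟩`. -/
def D112 : BinaryCode 112 :=
  (C112 ⊓ dual (Submodule.span (ZMod 2) {x112})) ⊔ Submodule.span (ZMod 2) {x112}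

/-- The four-circulant code `E₁₁₂`. -/
def E112 : BinaryCode 112 :=
  fourCirculantCode (m := 28)
    ![1,0,0,0,0,0,0,0,1,0,0,0,1,0,0,0,0,1,1,1,1,1,0,0,1,1,0,1]
    ![0,1,1,1,1,0,1,0,0,0,1,0,1,0,0,1,1,1,0,1,0,1,0,1,1,1,1,0]

end BinaryCode

/-!
Every row of the generator matrix of `C112` has odd inner product with `x112`, whose left half has
odd weight. Therefore `D112` is again a four-circulant code: its first rows are the complements of
those of `C112` (`inf_dual_sup_span_eq`). Hence `D112`, `E112` and the further code `H112`, which is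
given by its first rows, are all of the form `{(u, u N)}` with `N` the `56 × 56` matrix
`rightBlock a b`. That `N Nᵀ = 1` and that the rows of the generator matrix have weight divisible by
four are finite computations with the first rows. They imply that the code is doubly even and
self-dual.

*Minimum weight.* By double evenness it is enough to exclude the weights `1, …, 16`. A codeword
`(u, u N)` of such a weight has `u` of weight at most `8` or `u N` of weight at most `7`. Since
`u = (u N) Nᵀ` and `Nᵀ` is the matrix of the four-circulant code with the reversed first row `a`,
the second case is the first one for another code. The simultaneous rotations of the four blocks
and the reflection that interchanges the blocks in pairs act transitively on the coordinates of
`u`. As `3 · 8 < 28`, they can be used to arrange that `u` contains the first coordinate of the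
first block and none of the next three (`exists_gap`). It remains to see that the first row of `N`
plus at most seven of the last 52 rows is always heavy enough. These sums, about `1.3 · 10⁸` for
each of the three codes, are evaluated by the kernel in bit-sliced form: a family of words is kept
as a tree of columns, one large natural number for each coordinate, so that `Nat.xor`, `Nat.land`
and shifts act on all words of the family simultaneously, and the weights are found by a carry-save
addition of the columns (`scan_sound`, `scanSmall_sound`).

*Inequivalence.* For a code `C` let `wordsOfType C w d` be the set of the codewords `a` of weight
`w` such that the subcode of the words that vanish on the support of `a` has dimension `d`. Its
cardinality is an invariant of the equivalence class. The rotation by seven places and the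
reflection generate a dihedral group of order eight of automorphisms, and so the parity of the
cardinality is that of the number of elements fixed by this group
(`card_mod_two_eq_card_fixed_dihedral`). There are only `2 ^ 7` fixed codewords, as their left half
is determined by seven entries, and for each of them the dimension is found by elimination. For
`w = 48` the number of fixed elements with `d = 11` is `5` for `D112` and `8` for `E112`, and with
`d = 15` it is `0` for `D112` and `E112` and `1` for `H112`.
-/

/-! ### Bit-sliced families of binary words -/

namespace BitSlice

/-- A binary tree of natural numbers. Its nodes hold the columns of a bit-sliced family of binary
words: bit `k` of the column at a node is the entry, at that position, of the `k`-th word. -/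
inductive BTree where
  | nil
  | node (a : ℕ) (l r : BTree)

namespace BTree

/- The functions below are written with recursors and with the binary operations `Nat.xor`,
`Nat.land`, … in prefix form, because the kernel evaluates them. -/

/-- Applies a function to all entries. -/
noncomputable def map (f : ℕ → ℕ) (t : BTree) : BTree :=
  BTree.rec nil (fun a _ _ l r => node (f a) l r) t

/-- Combines the entries at the same node. -/
noncomputable def zip (f : ℕ → ℕ → ℕ) (t : BTree) : BTree → BTree :=
  BTree.rec (fun _ => nil)
    (fun a _ _ l r s => BTree.rec nil (fun b l' r' _ _ => node (f a b) (l l') (r r')) s) t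

/-- The sum of all entries. -/
noncomputable def total (t : BTree) : ℕ :=
  BTree.rec 0 (fun a _ _ l r => a + l + r) t

/-- The perfect tree of depth `d` with the entries `o, o + 1, …, o + 2 ^ d - 2`. -/
noncomputable def spread (d : ℕ) : ℕ → BTree :=
  Nat.rec (fun _ => nil)
    (fun d ih o => node o (ih (Nat.add o 1)) (ih (Nat.add o (Nat.pow 2 d)))) d

@[simp] theorem map_nil (f) : map f nil = nil := rfl
@[simp] theorem map_node (f a l r) : map f (node a l r) = node (f a) (map f l) (map f r) := rfl
@[simp] theorem zip_nil_left (f t) : zip f nil t = nil := rfl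
@[simp] theorem zip_nil_right (f t) : zip f t nil = nil := by cases t <;> rfl
@[simp] theorem zip_node (f a l r b l' r') :
    zip f (node a l r) (node b l' r') = node (f a b) (zip f l l') (zip f r r') := rfl
@[simp] theorem total_nil : total nil = 0 := rfl
@[simp] theorem total_node (a l r) : total (node a l r) = a + total l + total r := rfl
theorem spread_succ (d o) :
    spread (d + 1) o = node o (spread d (o + 1)) (spread d (o + 2 ^ d)) := rfl

theorem map_map (f g : ℕ → ℕ) (t : BTree) : map f (map g t) = map (fun x => f (g x)) t := by
  induction t <;> simp_all

theorem zip_map_map (f g h) (t : BTree) :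
    zip f (map g t) (map h t) = map (fun j => f (g j) (h j)) t := by
  induction t <;> simp_all

theorem total_map_spread (g : ℕ → ℕ) (d : ℕ) : ∀ o,
    total (map g (spread d o)) = ∑ j ∈ Finset.Ico o (o + (2 ^ d - 1)), g j := by
  induction d with
  | zero => intro o; simp [spread]
  | succ d ih =>
    intro o
    have h := Nat.one_le_two_pow (n := d)
    have h' : o + (2 ^ (d + 1) - 1) = o + 2 ^ d + (2 ^ d - 1) := by rw [pow_succ]; omega
    rw [spread_succ, map_node, total_node, ih, ih, h',
      Finset.sum_eq_sum_Ico_succ_bot (a := o) (by omega),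
      show o + 1 + (2 ^ d - 1) = o + 2 ^ d by omega, add_assoc,
      Finset.sum_Ico_consecutive g (by omega) (by omega)]

end BTree

open BTree

/-- The 63 bit positions of a word, arranged in a tree. -/
noncomputable def positions : BTree := spread 6 0

/-- The bits `0, …, 62` of a number, as a tree with entries `0` and `1`. -/
noncomputable def vec (v : ℕ) : BTree :=
  positions.map fun j => Nat.land (Nat.shiftRight v j) 1

/-- The `k`-th word of a bit-sliced family. -/
noncomputable def lane (k : ℕ) (F : BTree) : BTree := F.map fun c => (c.testBit k).toNat

/-- The number of ones among the bits `0, …, 62`. -/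
def weight (v : ℕ) : ℕ := ∑ j ∈ Finset.range 63, (v.testBit j).toNat

theorem vec_eq (v : ℕ) : vec v = positions.map fun j => (v.testBit j).toNat := by
  unfold vec
  congr 1
  funext j
  change (v >>> j) &&& 1 = _
  rw [Nat.and_one_is_mod, Nat.testBit, Nat.and_comm, Nat.and_one_is_mod]
  rcases Nat.mod_two_eq_zero_or_one (v >>> j) with h | h <;> simp [h]

theorem total_vec (v : ℕ) : total (vec v) = weight v := by
  rw [vec_eq, positions, total_map_spread, weight]
  simp

theorem zip_xor_vec (x y : ℕ) : zip Nat.xor (vec x) (vec y) = vec (x ^^^ y) := by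
  rw [vec_eq, vec_eq, vec_eq, zip_map_map]
  congr 1
  funext j
  change (x.testBit j).toNat ^^^ (y.testBit j).toNat = _
  rw [Nat.testBit_xor]
  cases x.testBit j <;> cases y.testBit j <;> rfl

theorem lane_zip {k k₁ k₂ : ℕ} {f g : ℕ → ℕ → ℕ}
    (h : ∀ c d, ((f c d).testBit k).toNat = g (c.testBit k₁).toNat (d.testBit k₂).toNat)
    (F : BTree) : ∀ G, lane k (zip f F G) = zip g (lane k₁ F) (lane k₂ G) := by
  unfold lane
  induction F with
  | nil => intro G; rfl
  | node a l r ihl ihr =>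
    intro G
    cases G with
    | nil => rfl
    | node b l' r' => simp [h, ihl, ihr]

/-- Adds a column to a little-endian list of counter slices. -/
noncomputable def inc (l : List ℕ) : ℕ → List ℕ :=
  List.rec (fun c => [c]) (fun b _ ih c => Nat.xor b c :: ih (Nat.land b c)) l

/-- Adds two little-endian lists of counter slices and a carry column. -/
noncomputable def addCarry (l : List ℕ) : List ℕ → ℕ → List ℕ :=
  List.rec inc (fun a as ih bs c => List.rec (inc (a :: as) c) (fun b bs' _ =>
    Nat.xor (Nat.xor a b) c ::
      ih bs' (Nat.lor (Nat.land a b) (Nat.land (Nat.xor a b) c))) bs) l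

/-- Adds the word `V` to every word of the family `F` of `K` words, where `mask = 2 ^ K - 1`. -/
noncomputable def translate (mask : ℕ) (F V : BTree) : BTree :=
  zip (fun c b => Nat.xor c (Nat.mul b mask)) F V

/-- The slices of the weights of all words of `translate mask F V`. -/
noncomputable def weights (mask : ℕ) (F : BTree) : BTree → List ℕ :=
  BTree.rec (fun _ => []) (fun a _ _ l r V => BTree.rec [] (fun b l' r' _ _ =>
    addCarry (l l') (r r') (Nat.xor a (Nat.mul b mask))) V) F

/-- The slices of the halves, rounded down. -/
noncomputable def tail (l : List ℕ) : List ℕ := List.rec [] (fun _ t _ => t) l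
/-- The disjunction of all slices: its bits mark the nonzero counters. -/
noncomputable def orAll (l : List ℕ) : ℕ := List.rec 0 (fun a _ ih => Nat.lor a ih) l

/-- All words of `translate mask F V` have weight at least `16`. -/
noncomputable def heavy (mask : ℕ) (F V : BTree) : Bool :=
  Nat.beq (orAll (tail (tail (tail (tail (weights mask F V)))))) mask

/-- The number in the `k`-th lane of a list of counter slices. -/
def value (k : ℕ) (l : List ℕ) : ℕ := l.foldr (fun c acc => (c.testBit k).toNat + 2 * acc) 0

@[simp] theorem value_nil (k) : value k [] = 0 := rfl
@[simp] theorem value_cons (k c l) : value k (c :: l) = (c.testBit k).toNat + 2 * value k l := rfl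

theorem value_inc (k : ℕ) (l : List ℕ) : ∀ c,
    value k (inc l c) = value k l + (c.testBit k).toNat := by
  induction l with
  | nil => intro c; simp [inc]
  | cons b bs ih =>
    intro c
    change value k ((b ^^^ c) :: inc bs (b &&& c)) = _
    rw [value_cons, ih, value_cons, Nat.testBit_xor, Nat.testBit_and]
    cases b.testBit k <;> cases c.testBit k <;> simp <;> omega

theorem value_addCarry (k : ℕ) (l : List ℕ) : ∀ m c,
    value k (addCarry l m c) = value k l + value k m + (c.testBit k).toNat := by
  induction l with
  | nil => intro m c; change value k (inc m c) = _; rw [value_inc]; simp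
  | cons a as ih =>
    intro m c
    cases m with
    | nil => change value k (inc (a :: as) c) = _; rw [value_inc]; simp
    | cons b bs =>
      change value k ((a ^^^ b ^^^ c) :: addCarry as bs ((a &&& b) ||| ((a ^^^ b) &&& c))) = _
      rw [value_cons, ih, value_cons, value_cons]
      simp only [Nat.testBit_xor, Nat.testBit_and, Nat.testBit_or]
      cases a.testBit k <;> cases b.testBit k <;> cases c.testBit k <;> simp <;> omega

theorem value_weights (k mask : ℕ) (F : BTree) : ∀ V,
    value k (weights mask F V) = total (lane k (translate mask F V)) := by
  induction F with
  | nil => intro V; rfl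
  | node a l r ihl ihr =>
    intro V
    cases V with
    | nil => rfl
    | node b l' r' =>
      change value k (addCarry (weights mask l l') (weights mask r r') (a ^^^ (b * mask))) = _
      rw [value_addCarry, ihl, ihr]
      change _ = total (node ((a ^^^ (b * mask)).testBit k).toNat
        (lane k (translate mask l l')) (lane k (translate mask r r')))
      rw [total_node]
      ring

theorem exists_of_testBit_orAll {k : ℕ} {l : List ℕ} (h : (orAll l).testBit k = true) :
    1 ≤ value k l := by
  induction l with
  | nil => simp [orAll] at h
  | cons a l ih =>
    change (a ||| orAll l).testBit k = true at h
    rw [Nat.testBit_or, Bool.or_eq_true] at h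
    rw [value_cons]
    rcases h with h | h
    · simp [h]
    · have := ih h; omega

theorem two_mul_value_tail_le (k : ℕ) (l : List ℕ) : 2 * value k (tail l) ≤ value k l := by
  cases l with
  | nil => simp [tail]
  | cons a l => change 2 * value k l ≤ _; simp

theorem sixteen_le_total_of_heavy {K : ℕ} {F V : BTree} (h : heavy (2 ^ K - 1) F V = true)
    {k : ℕ} (hk : k < K) : 16 ≤ total (lane k (translate (2 ^ K - 1) F V)) := by
  have h1 := Nat.eq_of_beq_eq_true h
  set w := weights (2 ^ K - 1) F V with hw
  have h2 : (orAll (tail (tail (tail (tail w))))).testBit k = true := by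
    rw [h1, Nat.testBit_two_pow_sub_one]; simpa using hk
  have h3 := exists_of_testBit_orAll h2
  have h4 := two_mul_value_tail_le k w
  have h5 := two_mul_value_tail_le k (tail w)
  have h6 := two_mul_value_tail_le k (tail (tail w))
  have h7 := two_mul_value_tail_le k (tail (tail (tail w)))
  rw [← value_weights, ← hw]
  omega

theorem lane_translate {K : ℕ} {F : BTree} {k x y : ℕ} (hk : k < K) (h : lane k F = vec x) :
    lane k (translate (2 ^ K - 1) F (vec y)) = vec (x ^^^ y) := by
  have key : ∀ (F : BTree) (I : BTree),
      lane k (translate (2 ^ K - 1) F (I.map fun j => (y.testBit j).toNat)) =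
        zip Nat.xor (lane k F) (I.map fun j => (y.testBit j).toNat) := by
    intro F
    induction F with
    | nil => intro I; rfl
    | node a l r ihl ihr =>
      intro I
      cases I with
      | nil => rfl
      | node b l' r' =>
        change node ((a ^^^ ((y.testBit b).toNat * (2 ^ K - 1))).testBit k).toNat _ _ =
          node ((a.testBit k).toNat ^^^ (y.testBit b).toNat) _ _
        congr 1
        · rw [Nat.testBit_xor]
          cases y.testBit b <;> cases a.testBit k <;> simp [hk]
        · exact ihl l'
        · exact ihr r'
  rw [vec_eq y, key, h, ← vec_eq, zip_xor_vec]

theorem lane_translate_of_le {K : ℕ} {F : BTree} {k y : ℕ} (hk : K ≤ k) (h : lane k F = vec 0) :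
    lane k (translate (2 ^ K - 1) F (vec y)) = vec 0 := by
  have key : ∀ (F : BTree) (I : BTree),
      lane k (translate (2 ^ K - 1) F (I.map fun j => (y.testBit j).toNat)) =
        zip (fun a _ => a) (lane k F) (I.map fun j => (y.testBit j).toNat) := by
    intro F
    induction F with
    | nil => intro I; rfl
    | node a l r ihl ihr =>
      intro I
      cases I with
      | nil => rfl
      | node b l' r' =>
        change node ((a ^^^ ((y.testBit b).toNat * (2 ^ K - 1))).testBit k).toNat _ _ =
          node ((a.testBit k).toNat) _ _
        congr 1
        · rw [Nat.testBit_xor]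
          have : ¬ k < K := by omega
          cases y.testBit b <;> simp [this]
        · exact ihl l'
        · exact ihr r'
  rw [vec_eq y, key, h, vec_eq, zip_map_map]

theorem weight_of_heavy {K : ℕ} {F : BTree} {k x y : ℕ}
    (h : heavy (2 ^ K - 1) F (vec y) = true) (hk : k < K) (hx : lane k F = vec x) :
    16 ≤ weight (x ^^^ y) := by
  have := sixteen_le_total_of_heavy h hk
  rwa [lane_translate hk hx, total_vec] at this

/-- A bit-sliced family of `size` words; `mask` is `2 ^ size - 1`. -/
structure Family where
  size : ℕ
  mask : ℕ
  cols : BTree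

/-- `mask` has the intended value and no column has a bit beyond the last word. -/
def Family.Valid (p : Family) : Prop :=
  p.mask = 2 ^ p.size - 1 ∧ ∀ k, p.size ≤ k → lane k p.cols = vec 0

/-- `x` is one of the words of the family. -/
def Family.Mem (x : ℕ) (p : Family) : Prop := ∃ k < p.size, lane k p.cols = vec x

/-- The words of `q`, followed by the words of `p` translated by `V`. -/
noncomputable def append (p q : Family) (V : BTree) : Family :=
  Family.rec (fun K _ F => Family.rec (fun K' mask' F' =>
    ⟨Nat.add K K', Nat.sub (Nat.pow 2 (Nat.add K K')) 1,
      zip (fun c d => Nat.lor c (Nat.shiftLeft d K)) F (translate mask' F' V)⟩) p) q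

theorem append_eq (p q : Family) (V : BTree) : append p q V =
    ⟨q.size + p.size, 2 ^ (q.size + p.size) - 1,
      zip (fun c d => c ||| (d <<< q.size)) q.cols (translate p.mask p.cols V)⟩ := rfl

theorem lane_append_right {K k x : ℕ} {F G : BTree} (hF : lane (K + k) F = vec 0)
    (hG : lane k G = vec x) :
    lane (K + k) (zip (fun c d => c ||| (d <<< K)) F G) = vec x := by
  rw [lane_zip (k₁ := K + k) (k₂ := k) (g := fun a b => a ||| b), hF, hG, vec_eq, vec_eq,
    zip_map_map]
  · simp
  · intro c d
    rw [Nat.testBit_or, Nat.testBit_shiftLeft, Nat.add_sub_cancel_left]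
    cases c.testBit (K + k) <;> cases d.testBit k <;> simp

theorem lane_append_left {K k k' x y : ℕ} {F G : BTree} (hk : k < K) (hF : lane k F = vec x)
    (hG : lane k' G = vec y) :
    lane k (zip (fun c d => c ||| (d <<< K)) F G) = vec x := by
  rw [lane_zip (k₁ := k) (k₂ := k') (g := fun a _ => a), hF, hG, vec_eq, vec_eq, zip_map_map]
  intro c d
  rw [Nat.testBit_or, Nat.testBit_shiftLeft]
  have : ¬ K ≤ k := by omega
  simp [this]

theorem Family.Valid.append {p q : Family} (hp : p.Valid) (hq : q.Valid) (y : ℕ) :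
    (append p q (vec y)).Valid := by
  rw [append_eq]
  refine ⟨rfl, fun k hk => ?_⟩
  obtain ⟨d, rfl⟩ := Nat.exists_eq_add_of_le (show q.size ≤ k by simp only at hk; omega)
  refine lane_append_right (hq.2 _ (by omega)) ?_
  rw [hp.1]
  have : p.size ≤ d := by simp only at hk; omega
  exact lane_translate_of_le this (hp.2 _ this)

theorem Family.Mem.append_left {p q : Family} {x : ℕ} (h : q.Mem x) (hp : p.Valid) (y : ℕ) :
    (append p q (vec y)).Mem x := by
  rw [append_eq]
  obtain ⟨k, hk, h⟩ := h
  refine ⟨k, by simp only; omega, lane_append_left hk h (k' := p.size) (y := 0) ?_⟩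
  rw [hp.1]
  exact lane_translate_of_le le_rfl (hp.2 _ le_rfl)

theorem Family.Mem.append_right {p q : Family} {x : ℕ} (h : p.Mem x) (hp : p.Valid)
    (hq : q.Valid) (y : ℕ) : (append p q (vec y)).Mem (x ^^^ y) := by
  rw [append_eq]
  obtain ⟨k, hk, h⟩ := h
  refine ⟨q.size + k, by simp only; omega, lane_append_right (hq.2 _ (by omega)) ?_⟩
  rw [hp.1]
  exact lane_translate hk h

/-- `p` contains the sums of `x` and `t` words of the list `P`. -/
def Covers (x : ℕ) (P : List ℕ) (t : ℕ) (p : Family) : Prop :=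
  p.Valid ∧ ∀ U : List ℕ, U.Sublist P → U.length = t → p.Mem (U.foldl (· ^^^ ·) x)

theorem Covers.append {x t r : ℕ} {P : List ℕ} {p q : Family} (hp : Covers x P t p)
    (hq : Covers x P (t + 1) q) : Covers x (P ++ [r]) (t + 1) (append p q (vec r)) := by
  refine ⟨hp.1.append hq.1 r, fun U hU hl => ?_⟩
  obtain ⟨U₁, U₂, rfl, h₁, h₂⟩ := List.sublist_append_iff.1 hU
  rcases List.sublist_singleton.1 h₂ with rfl | rfl
  · rw [List.append_nil] at hl ⊢
    exact (hq.2 _ h₁ hl).append_left hp.1 r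
  · rw [List.foldl_append]
    exact (hp.2 _ h₁ (by simpa using hl)).append_right hp.1 hq.1 r

/-- The families in the list `l` cover the sums of `t, t + 1, …` words of `P`. -/
def CoversFrom (x : ℕ) (P : List ℕ) : ℕ → List Family → Prop
  | _, [] => True
  | t, q :: l => Covers x P t q ∧ CoversFrom x P (t + 1) l

/-- Appends to every family of a list the translate by `V` of the family before it, where the
family before the first one is given separately. -/
noncomputable def step (V : BTree) (l : List Family) : Family → List Family :=
  List.rec (fun _ => []) (fun q _ ih p => append p q V :: ih q) l

/-- Passes from the sums of words of `P` to the sums of words of `P` and one further word `V`. -/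
noncomputable def stepAll (V : BTree) (l : List Family) : List Family :=
  List.rec [] (fun q t _ => q :: step V t q) l

theorem CoversFrom.step {x r : ℕ} {P : List ℕ} (l : List Family) : ∀ {t : ℕ} {p : Family},
    Covers x P t p → CoversFrom x P (t + 1) l →
      CoversFrom x (P ++ [r]) (t + 1) (step (vec r) l p) := by
  induction l with
  | nil => intros; trivial
  | cons q l ih => intro t p hp hl; exact ⟨hp.append hl.1, ih hl.1 hl.2⟩

theorem CoversFrom.stepAll {x r : ℕ} {P : List ℕ} {l : List Family} (h : CoversFrom x P 0 l) :
    CoversFrom x (P ++ [r]) 0 (stepAll (vec r) l) := by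
  cases l with
  | nil => trivial
  | cons q l =>
    refine ⟨⟨h.1.1, fun U _ hl => ?_⟩, CoversFrom.step l h.1 h.2⟩
    obtain rfl := List.length_eq_zero_iff.1 hl
    exact h.1.2 [] (List.nil_sublist _) rfl

/-- The last family of a list. -/
noncomputable def last (l : List Family) : Family :=
  List.rec ⟨0, 0, nil⟩ (fun q t ih => List.rec q (fun _ _ _ => ih) t) l

theorem length_step (V : BTree) (l : List Family) : ∀ p, (step V l p).length = l.length := by
  induction l with
  | nil => intro p; rfl
  | cons q l ih => intro p; exact congrArg (· + 1) (ih q)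

theorem length_stepAll (V : BTree) (l : List Family) : (stepAll V l).length = l.length := by
  cases l with
  | nil => rfl
  | cons q l => exact congrArg (· + 1) (length_step V l q)

theorem CoversFrom.last {x : ℕ} {P : List ℕ} (l : List Family) : ∀ {t : ℕ},
    l ≠ [] → CoversFrom x P t l → Covers x P (t + l.length - 1) (last l) := by
  induction l with
  | nil => intro t h; exact absurd rfl h
  | cons q l ih =>
    intro t _ h
    cases l with
    | nil => exact h.1
    | cons q' l =>
      have := ih (by simp) h.2
      rwa [show t + 1 + (q' :: l).length - 1 = t + (q :: q' :: l).length - 1 by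
        simp only [List.length_cons]; omega] at this

/-- The families of sums of `0, …, 5` words of the empty list. -/
noncomputable def start (x : ℕ) : List Family :=
  ⟨1, 1, vec x⟩ :: List.replicate 5 ⟨0, 0, vec 0⟩

theorem lane_vec_zero (x : ℕ) : lane 0 (vec x) = vec x := by
  rw [vec_eq, lane, map_map]
  congr 1
  funext j
  cases x.testBit j <;> rfl

theorem lane_vec_of_pos (x : ℕ) {k : ℕ} (hk : 0 < k) : lane k (vec x) = vec 0 := by
  rw [vec_eq, vec_eq, lane, map_map]
  congr 1
  funext j
  have : Nat.testBit 1 k = false := by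
    simpa [hk.ne'] using Nat.testBit_two_pow_sub_one 1 k
  cases x.testBit j <;> simp [this]

theorem coversFrom_start (x : ℕ) : CoversFrom x [] 0 (start x) := by
  have h0 : (⟨0, 0, vec 0⟩ : Family).Valid := by
    refine ⟨rfl, fun k _ => ?_⟩
    rcases Nat.eq_zero_or_pos k with rfl | hk
    · exact lane_vec_zero 0
    · exact lane_vec_of_pos 0 hk
  have h1 : ∀ t, Covers x [] (t + 1) ⟨0, 0, vec 0⟩ := fun t =>
    ⟨h0, fun U hU hl => by simp [List.sublist_nil.1 hU] at hl⟩
  refine ⟨⟨⟨rfl, fun k hk => lane_vec_of_pos x hk⟩, fun U hU _ => ?_⟩, h1 _, h1 _, h1 _, h1 _, h1 _,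
    trivial⟩
  rw [List.sublist_nil.1 hU]
  exact ⟨0, Nat.one_pos, lane_vec_zero x⟩

/-- A word with `s` ones at the first of the seven positions that follow the position `55`. A sum of
`s + 1` rows, of which the first is fixed, is required to have weight at least `16 - s`. Adding
`padding s` to it turns this into a bound that does not depend on `s` and that can be read off from
the slices of the weight beyond the fourth. -/
def padding (s : ℕ) : ℕ := (2 ^ s - 1) * 2 ^ 56

/-- The conjunction of `f` over a list, evaluated only up to the first failure. -/
noncomputable def allTrue (f : BTree → Bool) (l : List BTree) : Bool :=
  List.rec true (fun a _ ih => Bool.rec false ih (f a)) l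

theorem allTrue_iff {f : BTree → Bool} {l : List BTree} :
    allTrue f l = true ↔ ∀ a ∈ l, f a = true := by
  induction l with
  | nil => simp [allTrue]
  | cons a l ih =>
    change (Bool.rec false (allTrue f l) (f a) : Bool) = true ↔ _
    cases h : f a <;> simp [h, ih]

/-- Runs through the words of a list of words. For every word `r` whose number `n` lies between
`lo` and `hi`, it checks the weights of the sums of `x`, five words before `r`, and `r`; if `pairs`
is `true`, also the weights of these sums plus one word after `r`. -/
noncomputable def scan (pairs : Bool) (lo hi : ℕ) (rows : List BTree) : ℕ → List Family → Bool :=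
  List.rec (fun _ _ => true) (fun r rest ih n T =>
    Bool.rec false (Bool.rec (ih (Nat.succ n) (stepAll r T)) true (Nat.ble hi n))
      (Bool.rec true (Family.rec (fun _ mask F =>
        Bool.rec false
          (Bool.rec true (allTrue (heavy mask
            (translate mask (translate mask F r) (vec (padding 7)))) rest) pairs)
          (heavy mask (translate mask F r) (vec (padding 6)))) (last T)) (Nat.ble lo n))) rows

theorem scan_cons (pairs lo hi r rest n T) : scan pairs lo hi (r :: rest) n T =
    Bool.rec false (Bool.rec (scan pairs lo hi rest (n + 1) (stepAll r T)) true (Nat.ble hi n))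
      (Bool.rec true (
        Bool.rec false
          (Bool.rec true (allTrue (heavy (last T).mask
            (translate (last T).mask (translate (last T).mask (last T).cols r)
              (vec (padding 7)))) rest) pairs)
          (heavy (last T).mask (translate (last T).mask (last T).cols r) (vec (padding 6))))
        (Nat.ble lo n)) := rfl

theorem bool_rec_and {a b : Bool} (h : (Bool.rec false a b : Bool) = true) :
    b = true ∧ a = true := by
  cases b
  · exact absurd h (by simp)
  · exact ⟨rfl, h⟩

theorem scan_sound {pairs : Bool} {lo hi x : ℕ} (rows : List ℕ) : ∀ {P : List ℕ} {T : List Family},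
    T.length = 6 → CoversFrom x P 0 T →
    scan pairs lo hi (rows.map vec) P.length T = true →
    ∀ (Q : List ℕ) (r : ℕ) (rest : List ℕ), rows = Q ++ r :: rest →
      lo ≤ (P ++ Q).length → (P ++ Q).length ≤ hi →
      ∀ U : List ℕ, U.Sublist (P ++ Q) → U.length = 5 →
        16 ≤ weight (U.foldl (· ^^^ ·) x ^^^ r ^^^ padding 6) ∧
        (pairs = true → ∀ r' ∈ rest,
          16 ≤ weight (U.foldl (· ^^^ ·) x ^^^ r ^^^ padding 7 ^^^ r')) := by
  induction rows with
  | nil => intro P T _ _ _ Q r rest h; simp at h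
  | cons r₀ rows ih =>
    intro P T hT hC h Q r rest hQ hlo hhi U hU hl
    rw [List.map_cons, scan_cons] at h
    obtain ⟨h1, h2⟩ := bool_rec_and h
    cases Q with
    | nil =>
      obtain ⟨rfl, rfl⟩ : r₀ = r ∧ rows = rest := by simpa using hQ
      rw [List.append_nil] at hlo hU
      rw [Nat.ble_eq_true_of_le hlo] at h1
      obtain ⟨h3, h4⟩ := bool_rec_and h1
      have hcov := CoversFrom.last T (by rintro rfl; simp at hT) hC
      rw [hT] at hcov
      obtain ⟨k, hk, hx⟩ := hcov.2 U hU hl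
      rw [hcov.1.1] at h3 h4
      have hx' := lane_translate (y := r₀) hk hx
      refine ⟨weight_of_heavy h3 hk hx', ?_⟩
      rintro rfl r' hr'
      exact weight_of_heavy (allTrue_iff.1 h4 _ (List.mem_map_of_mem hr')) hk
        (lane_translate hk hx')
    | cons q Q =>
      obtain ⟨rfl, hQ'⟩ : r₀ = q ∧ rows = Q ++ r :: rest := by simpa using hQ
      have hn : Nat.ble hi P.length = false := by
        rw [Bool.eq_false_iff]
        intro hc
        have := Nat.le_of_ble_eq_true hc
        simp at hhi
        omega
      rw [hn] at h2
      have hlen : P.length + 1 = (P ++ [r₀]).length := by simp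
      rw [hlen] at h2
      refine ih ((length_stepAll _ _).trans hT) hC.stepAll h2 Q r rest hQ' ?_ ?_ U ?_ hl
      · simpa using hlo
      · simpa using hhi
      · simpa using hU

/-- Checks the weights of the words of a list of families. In the family of sums of `t` words, `t`
ones are added to each weight. -/
noncomputable def finalCheck (T : List Family) : ℕ → Bool :=
  List.rec (fun _ => true) (fun q _ ih t =>
    Bool.rec false (ih (Nat.succ t)) (heavy q.mask q.cols (vec (padding t)))) T

/-- Checks the weights of the sums of `x` and at most five words, where `x` is the word from which
the initial list of families has been made. -/
noncomputable def scanSmall (rows : List BTree) : List Family → Bool :=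
  List.rec (fun T => finalCheck T 0) (fun r _ ih T => ih (stepAll r T)) rows

theorem finalCheck_sound {x : ℕ} {P : List ℕ} (T : List Family) : ∀ {t : ℕ}, CoversFrom x P t T →
    finalCheck T t = true → ∀ U : List ℕ, U.Sublist P → t ≤ U.length → U.length < t + T.length →
      16 ≤ weight (U.foldl (· ^^^ ·) x ^^^ padding U.length) := by
  induction T with
  | nil => intro t _ _ U _ h1 h2; simp at h2; omega
  | cons q T ih =>
    intro t hC h U hU h1 h2
    obtain ⟨h3, h4⟩ := bool_rec_and (show (Bool.rec false (finalCheck T (t + 1))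
      (heavy q.mask q.cols (vec (padding t))) : Bool) = true from h)
    rcases h1.eq_or_lt with rfl | h1
    · obtain ⟨k, hk, hx⟩ := hC.1.2 U hU rfl
      rw [hC.1.1.1] at h3
      exact weight_of_heavy h3 hk hx
    · exact ih hC.2 h4 U hU h1 (by simp at h2; omega)

theorem scanSmall_sound {x : ℕ} (rows : List ℕ) : ∀ {P : List ℕ} {T : List Family},
    T.length = 6 → CoversFrom x P 0 T → scanSmall (rows.map vec) T = true →
    ∀ U : List ℕ, U.Sublist (P ++ rows) → U.length ≤ 5 →
      16 ≤ weight (U.foldl (· ^^^ ·) x ^^^ padding U.length) := by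
  induction rows with
  | nil =>
    intro P T hT hC h U hU hl
    rw [List.append_nil] at hU
    exact finalCheck_sound T hC h U hU (Nat.zero_le _) (by omega)
  | cons r rows ih =>
    intro P T hT hC h U hU hl
    refine ih ((length_stepAll _ _).trans hT) (hC.stepAll (r := r)) h U ?_ hl
    simpa using hU

end BitSlice

namespace BinaryCode

/-! ### Four-circulant codes -/

section FourCirculant

variable {m : ℕ}

/-- The right half of the generator matrix of a four-circulant code. -/
def rightBlock (a b : Fin m → ZMod 2) : Matrix (Fin m ⊕ Fin m) (Fin m ⊕ Fin m) (ZMod 2) :=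
  Matrix.fromBlocks (rowCirculant a) (rowCirculant b)
    (rowCirculant b).transpose (rowCirculant a).transpose

/-- The restriction of a word to the first two blocks. -/
def left (v : Fin ((m + m) + (m + m)) → ZMod 2) : Fin m ⊕ Fin m → ZMod 2 :=
  fun i => v (fourBlockEquiv m (Sum.inl i))

/-- The restriction of a word to the last two blocks. -/
def right (v : Fin ((m + m) + (m + m)) → ZMod 2) : Fin m ⊕ Fin m → ZMod 2 :=
  fun i => v (fourBlockEquiv m (Sum.inr i))

/-- The word with given halves. -/
def glue (l r : Fin m ⊕ Fin m → ZMod 2) : Fin ((m + m) + (m + m)) → ZMod 2 :=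
  fun j => Sum.elim l r ((fourBlockEquiv m).symm j)

@[simp] theorem left_glue (l r : Fin m ⊕ Fin m → ZMod 2) : left (glue l r) = l := by
  funext i; simp [left, glue]

@[simp] theorem right_glue (l r : Fin m ⊕ Fin m → ZMod 2) : right (glue l r) = r := by
  funext i; simp [right, glue]

theorem glue_left_right (v : Fin ((m + m) + (m + m)) → ZMod 2) : glue (left v) (right v) = v := by
  funext j
  obtain ⟨i, rfl⟩ := (fourBlockEquiv m).surjective j
  rcases i with i | i <;> simp [left, right, glue]

theorem ext_halves {v w : Fin ((m + m) + (m + m)) → ZMod 2} (hl : left v = left w)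
    (hr : right v = right w) : v = w := by
  rw [← glue_left_right v, hl, hr, glue_left_right]

theorem sum_eq_sum_halves {M : Type*} [AddCommMonoid M] (f : Fin ((m + m) + (m + m)) → M) :
    ∑ j, f j = ∑ i, f (fourBlockEquiv m (Sum.inl i)) + ∑ i, f (fourBlockEquiv m (Sum.inr i)) := by
  rw [← (fourBlockEquiv m).sum_comp, Fintype.sum_sum_type]

theorem dotProduct_eq_halves (v w : Fin ((m + m) + (m + m)) → ZMod 2) :
    v ⬝ᵥ w = left v ⬝ᵥ left w + right v ⬝ᵥ right w :=
  sum_eq_sum_halves _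

theorem hammingNorm_eq_sum {ι : Type*} [Fintype ι] (v : ι → ZMod 2) :
    hammingNorm v = ∑ i, if v i ≠ 0 then 1 else 0 := by
  rw [hammingNorm, Finset.card_filter]

theorem hammingNorm_comp_equiv {ι κ : Type*} [Fintype ι] [Fintype κ] (e : ι ≃ κ)
    (v : κ → ZMod 2) : hammingNorm (fun i => v (e i)) = hammingNorm v := by
  rw [hammingNorm_eq_sum, hammingNorm_eq_sum, ← e.sum_comp]

theorem hammingNorm_eq_halves (v : Fin ((m + m) + (m + m)) → ZMod 2) :
    hammingNorm v = hammingNorm (left v) + hammingNorm (right v) := by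
  simp only [hammingNorm_eq_sum]
  exact sum_eq_sum_halves _

theorem sum_smul_generator (a b : Fin m → ZMod 2) (c : Fin m ⊕ Fin m → ZMod 2) :
    (∑ i, c i • fun j => fourCirculantGenerator a b i ((fourBlockEquiv m).symm j)) =
      glue c (Matrix.vecMul c (rightBlock a b)) := by
  apply ext_halves
  · rw [left_glue]
    funext i
    simp [left, fourCirculantGenerator, Matrix.one_apply]
  · rw [right_glue]
    funext i
    simp [right, fourCirculantGenerator, Matrix.vecMul, dotProduct, rightBlock]

theorem mem_fourCirculantCode {a b : Fin m → ZMod 2} {v : Fin ((m + m) + (m + m)) → ZMod 2} :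
    v ∈ fourCirculantCode a b ↔ right v = Matrix.vecMul (left v) (rightBlock a b) := by
  unfold fourCirculantCode
  rw [Submodule.mem_span_range_iff_exists_fun]
  constructor
  · rintro ⟨c, rfl⟩
    rw [sum_smul_generator, left_glue, right_glue]
  · intro h
    exact ⟨left v, by rw [sum_smul_generator, ← h, glue_left_right]⟩

theorem glue_mem (a b : Fin m → ZMod 2) (c : Fin m ⊕ Fin m → ZMod 2) :
    glue c (Matrix.vecMul c (rightBlock a b)) ∈ fourCirculantCode a b := by
  rw [mem_fourCirculantCode, left_glue, right_glue]

/-- A codeword is determined by its left half, which is arbitrary. -/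
noncomputable def leftEquiv (a b : Fin m → ZMod 2) :
    fourCirculantCode a b ≃ₗ[ZMod 2] (Fin m ⊕ Fin m → ZMod 2) where
  toFun v := left v.1
  map_add' _ _ := rfl
  map_smul' _ _ := rfl
  invFun c := ⟨_, glue_mem a b c⟩
  left_inv v := by
    apply Subtype.ext
    change glue (left v.1) _ = v.1
    rw [← mem_fourCirculantCode.1 v.2, glue_left_right]
  right_inv c := left_glue _ _

theorem finrank_fourCirculantCode (a b : Fin m → ZMod 2) :
    Module.finrank (ZMod 2) (fourCirculantCode a b) = m + m := by
  rw [(leftEquiv a b).finrank_eq, Module.finrank_fintype_fun_eq_card]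
  simp

theorem isSelfDual_of_mul_transpose {a b : Fin m → ZMod 2}
    (h : rightBlock a b * (rightBlock a b).transpose = 1) :
    (fourCirculantCode a b).IsSelfDual := by
  have h' : (rightBlock a b).transpose * rightBlock a b = 1 := mul_eq_one_comm.1 h
  apply le_antisymm
  · intro v hv w hw
    rw [mem_fourCirculantCode] at hv hw
    rw [dotProduct_eq_halves, hv, hw, ← Matrix.mulVec_transpose _ (left w),
      ← Matrix.dotProduct_mulVec, Matrix.mulVec_mulVec, h, Matrix.one_mulVec,
      CharTwo.add_self_eq_zero]
  · intro v hv
    have key : ∀ c, left v ⬝ᵥ c + right v ⬝ᵥ Matrix.vecMul c (rightBlock a b) = 0 := by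
      intro c
      have := hv _ (glue_mem a b c)
      rwa [dotProduct_eq_halves, left_glue, right_glue] at this
    have h1 : left v = Matrix.mulVec (rightBlock a b) (right v) := by
      apply dotProduct_eq
      intro c
      have := key c
      rwa [dotProduct_comm (right v), ← Matrix.dotProduct_mulVec, CharTwo.add_eq_zero,
        dotProduct_comm c] at this
    rw [mem_fourCirculantCode, h1, Matrix.vecMul_mulVec, h', Matrix.vecMul_one]

theorem rowCirculant_apply (r : Fin m → ZMod 2) (i j : Fin m) :
    rowCirculant r i j = r (j - i) := rfl

/-- The orthogonality of the generator matrix is a condition on the first rows only. -/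
theorem rightBlock_mul_transpose [NeZero m] {a b : Fin m → ZMod 2}
    (h : ∀ k : Fin m, ∑ j, (a j * a (j - k) + b j * b (j - k)) = if k = 0 then 1 else 0) :
    rightBlock a b * (rightBlock a b).transpose = 1 := by
  have ha : rowCirculant a = Matrix.circulant fun i => a (-i) := Matrix.transpose_circulant a
  have hb : rowCirculant b = Matrix.circulant fun i => b (-i) := Matrix.transpose_circulant b
  have ha' : (rowCirculant a).transpose = Matrix.circulant a := Matrix.transpose_transpose _
  have hb' : (rowCirculant b).transpose = Matrix.circulant b := Matrix.transpose_transpose _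
  have h1 : rowCirculant a * (rowCirculant a).transpose +
      rowCirculant b * (rowCirculant b).transpose = 1 := by
    ext i j
    have := h (j - i)
    rw [Matrix.add_apply, Matrix.mul_apply, Matrix.mul_apply, ← Finset.sum_add_distrib,
      Matrix.one_apply, ← Equiv.sum_comp (Equiv.addRight i)]
    simp only [sub_eq_zero, eq_comm (a := j)] at this
    rw [← this]
    refine Finset.sum_congr rfl fun k _ => ?_
    simp only [Matrix.transpose_apply, rowCirculant_apply, Equiv.coe_addRight,
      add_sub_cancel_right, sub_sub_eq_add_sub]
  rw [rightBlock, Matrix.fromBlocks_transpose, Matrix.fromBlocks_multiply,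
    Matrix.transpose_transpose, Matrix.transpose_transpose, h1, ← Matrix.fromBlocks_one]
  congr 1
  · rw [ha, hb, Matrix.circulant_mul_comm, CharTwo.add_self_eq_zero]
  · rw [ha', hb', Matrix.circulant_mul_comm, CharTwo.add_self_eq_zero]
  · rw [ha', hb', ha, hb] at h1
    rw [ha', hb', ha, hb, Matrix.circulant_mul_comm b, Matrix.circulant_mul_comm a, add_comm, h1]

/-- Interchanging the halves of the words turns a self-dual four-circulant code into the
four-circulant code whose block `A` is transposed. -/
theorem glue_right_left_mem {a b : Fin m → ZMod 2} [NeZero m]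
    (h : rightBlock a b * (rightBlock a b).transpose = 1) {v : Fin ((m + m) + (m + m)) → ZMod 2}
    (hv : v ∈ fourCirculantCode a b) :
    glue (right v) (left v) ∈ fourCirculantCode (fun i => a (-i)) b := by
  have ht : rightBlock (fun i => a (-i)) b = (rightBlock a b).transpose := by
    rw [rightBlock, rightBlock, Matrix.fromBlocks_transpose, Matrix.transpose_transpose,
      Matrix.transpose_transpose]
    congr 1
    · ext i j; simp [rowCirculant_apply]
    · ext i j; simp [rowCirculant_apply]
  rw [mem_fourCirculantCode] at hv ⊢
  rw [left_glue, right_glue, ht, hv, Matrix.vecMul_vecMul, h, Matrix.vecMul_one]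

/-! ### Symmetries -/

/-- The permutation of the coordinates that acts on both halves by `π`. -/
def relabel (π : Equiv.Perm (Fin m ⊕ Fin m)) : Equiv.Perm (Fin ((m + m) + (m + m))) :=
  ((fourBlockEquiv m).symm.trans (Equiv.sumCongr π π)).trans (fourBlockEquiv m)

theorem left_comp_relabel (π : Equiv.Perm (Fin m ⊕ Fin m)) (v : Fin ((m + m) + (m + m)) → ZMod 2) :
    left (fun j => v (relabel π j)) = fun i => left v (π i) := by
  funext i; simp [left, relabel]

theorem right_comp_relabel (π : Equiv.Perm (Fin m ⊕ Fin m))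
    (v : Fin ((m + m) + (m + m)) → ZMod 2) :
    right (fun j => v (relabel π j)) = fun i => right v (π i) := by
  funext i; simp [right, relabel]

theorem comp_relabel_mem {a b : Fin m → ZMod 2} {π : Equiv.Perm (Fin m ⊕ Fin m)}
    (hπ : ∀ i j, rightBlock a b (π i) (π j) = rightBlock a b i j)
    {v : Fin ((m + m) + (m + m)) → ZMod 2} (hv : v ∈ fourCirculantCode a b) :
    (fun j => v (relabel π j)) ∈ fourCirculantCode a b := by
  rw [mem_fourCirculantCode] at hv ⊢
  rw [left_comp_relabel, right_comp_relabel, hv]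
  funext j
  simp only [Matrix.vecMul, dotProduct]
  rw [← Equiv.sum_comp π]
  exact Finset.sum_congr rfl fun i _ => by rw [hπ]

/-- The simultaneous rotation of the blocks by `k` places. -/
def rotation [NeZero m] (k : Fin m) : Equiv.Perm (Fin m ⊕ Fin m) :=
  Equiv.sumCongr (Equiv.addRight k) (Equiv.addRight k)

/-- The reflection: it interchanges the two blocks and reverses their cyclic order. -/
def reflection [NeZero m] : Equiv.Perm (Fin m ⊕ Fin m) :=
  (Equiv.sumComm _ _).trans (Equiv.sumCongr (Equiv.neg _) (Equiv.neg _))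

theorem rightBlock_rotation [NeZero m] (a b : Fin m → ZMod 2) (k : Fin m) (i j) :
    rightBlock a b (rotation k i) (rotation k j) = rightBlock a b i j := by
  rcases i with i | i <;> rcases j with j | j <;>
    simp [rightBlock, rotation, rowCirculant_apply]

theorem rightBlock_reflection [NeZero m] (a b : Fin m → ZMod 2) (i j) :
    rightBlock a b (reflection i) (reflection j) = rightBlock a b i j := by
  rcases i with i | i <;> rcases j with j | j <;>
    simp [rightBlock, reflection, rowCirculant_apply, neg_add_eq_sub]

end FourCirculant

/-! ### Weights modulo four -/

theorem hammingNorm_add {ι : Type*} [Fintype ι] (v w : ι → ZMod 2) :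
    hammingNorm (v + w) + 2 * hammingNorm (v * w) = hammingNorm v + hammingNorm w := by
  simp only [hammingNorm_eq_sum, Finset.mul_sum, ← Finset.sum_add_distrib]
  refine Finset.sum_congr rfl fun i _ => ?_
  rw [Pi.add_apply, Pi.mul_apply]
  generalize v i = x
  generalize w i = y
  revert x y
  decide

theorem natCast_hammingNorm {ι : Type*} [Fintype ι] (v : ι → ZMod 2) :
    (hammingNorm v : ZMod 2) = ∑ i, v i := by
  rw [hammingNorm_eq_sum, Nat.cast_sum]
  refine Finset.sum_congr rfl fun i _ => ?_
  generalize v i = x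
  revert x
  decide

theorem four_dvd_hammingNorm_add {ι : Type*} [Fintype ι] {v w : ι → ZMod 2}
    (hv : 4 ∣ hammingNorm v) (hw : 4 ∣ hammingNorm w) (h : v ⬝ᵥ w = 0) :
    4 ∣ hammingNorm (v + w) := by
  have h1 := hammingNorm_add v w
  have h2 : 2 ∣ hammingNorm (v * w) := by
    rw [← ZMod.natCast_eq_zero_iff, natCast_hammingNorm]
    exact h
  omega

theorem four_dvd_hammingNorm_of_mem_span {n : ℕ} {s : Set (Fin n → ZMod 2)}
    (horth : Submodule.span (ZMod 2) s ≤ BinaryCode.dual (Submodule.span (ZMod 2) s))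
    (hs : ∀ v ∈ s, 4 ∣ hammingNorm v) {v : Fin n → ZMod 2}
    (hv : v ∈ Submodule.span (ZMod 2) s) : 4 ∣ hammingNorm v := by
  induction hv using Submodule.span_induction with
  | mem v h => exact hs v h
  | zero => simp
  | add v w hv hw ihv ihw => exact four_dvd_hammingNorm_add ihv ihw (horth hv w hw)
  | smul c v _ ih =>
    rcases (show ∀ c : ZMod 2, c = 0 ∨ c = 1 by decide) c with rfl | rfl
    · simp
    · rwa [one_smul]

section FourCirculant

variable {m : ℕ}

theorem hammingNorm_generator [NeZero m] (a b : Fin m → ZMod 2) (i : Fin m ⊕ Fin m) :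
    hammingNorm (glue (Pi.single i 1) (Matrix.vecMul (Pi.single i 1) (rightBlock a b))) =
      1 + (hammingNorm a + hammingNorm b) := by
  rw [hammingNorm_eq_halves, left_glue, right_glue, Matrix.single_one_vecMul]
  congr 1
  · rw [hammingNorm_eq_sum, Finset.sum_eq_single i] <;> simp +contextual
  · simp only [hammingNorm_eq_sum, Fintype.sum_sum_type]
    rcases i with i | i
    · rw [← (Equiv.subRight i).sum_comp (fun j => if a j ≠ 0 then 1 else 0),
        ← (Equiv.subRight i).sum_comp (fun j => if b j ≠ 0 then 1 else 0)]
      rfl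
    · rw [← (Equiv.subLeft i).sum_comp (fun j => if a j ≠ 0 then 1 else 0),
        ← (Equiv.subLeft i).sum_comp (fun j => if b j ≠ 0 then 1 else 0), add_comm]
      rfl

theorem isDoublyEvenSelfDual_of [NeZero m] {a b : Fin m → ZMod 2}
    (h : rightBlock a b * (rightBlock a b).transpose = 1)
    (hw : 4 ∣ 1 + (hammingNorm a + hammingNorm b)) :
    (fourCirculantCode a b).IsDoublyEvenSelfDual := by
  have hsd := isSelfDual_of_mul_transpose h
  refine ⟨hsd, fun v hv => four_dvd_hammingNorm_of_mem_span hsd.le ?_ hv⟩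
  rintro _ ⟨i, rfl⟩
  rw [← hammingNorm_generator a b i] at hw
  convert hw using 2
  apply ext_halves
  · rw [left_glue]
    funext j
    simp [left, fourCirculantGenerator, Matrix.one_apply, Pi.single_apply, eq_comm]
  · rw [right_glue]
    funext j
    simp [right, fourCirculantGenerator, rightBlock]

/-! ### Neighbors of four-circulant codes -/

theorem vecMul_rightBlock_complement (a b : Fin m → ZMod 2) (c : Fin m ⊕ Fin m → ZMod 2) (j) :
    Matrix.vecMul c (rightBlock (1 + a) (1 + b)) j =
      ∑ i, c i + Matrix.vecMul c (rightBlock a b) j := by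
  have h : ∀ i, rightBlock (1 + a) (1 + b) i j = 1 + rightBlock a b i j := by
    intro i
    rcases i with i | i <;> rcases j with j | j <;> simp [rightBlock, rowCirculant_apply]
  simp only [Matrix.vecMul, dotProduct, h, mul_add, mul_one, Finset.sum_add_distrib]

theorem mem_complement_iff {a b : Fin m → ZMod 2} {v : Fin ((m + m) + (m + m)) → ZMod 2}
    (h : ∑ i, left v i = 0) :
    v ∈ fourCirculantCode (1 + a) (1 + b) ↔ v ∈ fourCirculantCode a b := by
  have h1 : Matrix.vecMul (left v) (rightBlock (1 + a) (1 + b)) =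
      Matrix.vecMul (left v) (rightBlock a b) := by
    funext j
    rw [vecMul_rightBlock_complement, h, zero_add]
  rw [mem_fourCirculantCode, mem_fourCirculantCode, h1]

theorem sum_left_eq_zero_of_mem [NeZero m] {a b : Fin m → ZMod 2}
    {v : Fin ((m + m) + (m + m)) → ZMod 2} (hv : v ∈ fourCirculantCode a b)
    (hv' : v ∈ fourCirculantCode (1 + a) (1 + b)) : ∑ i, left v i = 0 := by
  rw [mem_fourCirculantCode] at hv hv'
  have h := vecMul_rightBlock_complement a b (left v) (Sum.inl 0)
  rwa [← hv, ← hv', right_eq_add] at h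

/-- The neighbor of a four-circulant code defined by a vector that is orthogonal to no row of the
generator matrix is the four-circulant code with complemented first rows. -/
theorem inf_dual_sup_span_eq {a b : Fin m → ZMod 2} {x : Fin ((m + m) + (m + m)) → ZMod 2}
    (hx : ∀ i, left x i + Matrix.mulVec (rightBlock a b) (right x) i = 1)
    (hx' : x ∈ fourCirculantCode (1 + a) (1 + b)) (hs : ∑ i, left x i = 1) :
    (fourCirculantCode a b ⊓ dual (Submodule.span (ZMod 2) {x})) ⊔ Submodule.span (ZMod 2) {x} =
      fourCirculantCode (1 + a) (1 + b) := by
  have hdual : ∀ v ∈ fourCirculantCode a b,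
      (v ∈ dual (Submodule.span (ZMod 2) {x}) ↔ ∑ i, left v i = 0) := by
    intro v hv
    have h1 : v ⬝ᵥ x = ∑ i, left v i := by
      rw [dotProduct_eq_halves, mem_fourCirculantCode.1 hv, ← Matrix.dotProduct_mulVec,
        ← dotProduct_add, show left x + Matrix.mulVec (rightBlock a b) (right x) = 1 from funext hx,
        dotProduct_one]
    rw [← h1]
    constructor
    · exact fun h => h x (Submodule.mem_span_singleton_self x)
    · intro h y hy
      obtain ⟨c, rfl⟩ := Submodule.mem_span_singleton.1 hy
      rw [dotProduct_smul, h, smul_zero]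
  apply le_antisymm
  · refine sup_le ?_ ((Submodule.span_singleton_le_iff_mem _ _).2 hx')
    rintro v ⟨hv, hv'⟩
    exact (mem_complement_iff ((hdual v hv).1 hv')).2 hv
  · have key : ∀ v ∈ fourCirculantCode (1 + a) (1 + b), ∑ i, left v i = 0 →
        v ∈ fourCirculantCode a b ⊓ dual (Submodule.span (ZMod 2) {x}) := by
      intro v hv h0
      have := (mem_complement_iff h0).1 hv
      exact ⟨this, (hdual v this).2 h0⟩
    intro v hv
    rcases (show ∀ c : ZMod 2, c = 0 ∨ c = 1 by decide) (∑ i, left v i) with h0 | h1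
    · exact Submodule.mem_sup_left (key v hv h0)
    · have h2 : v = (v + x) + x := by
        funext j
        simp [add_assoc, CharTwo.add_self_eq_zero]
      rw [h2]
      refine Submodule.add_mem_sup (key _ (add_mem hv hx') ?_) (Submodule.mem_span_singleton_self x)
      change ∑ i, (left v i + left x i) = 0
      rw [Finset.sum_add_distrib, h1, hs]
      rfl

end FourCirculant

/-- Imposing a linear condition that a subspace does not satisfy lowers its dimension by one. -/
theorem finrank_inf_ker_add_one {K E : Type*} [Field K] [AddCommGroup E] [Module K E]
    [FiniteDimensional K E] (V : Submodule K E) (φ : E →ₗ[K] K) {v : E} (hv : v ∈ V)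
    (h : φ v ≠ 0) : Module.finrank K (V ⊓ LinearMap.ker φ : Submodule K E) + 1 =
      Module.finrank K V := by
  have h1 := (φ.domRestrict V).finrank_range_add_finrank_ker
  have h2 : LinearMap.range (φ.domRestrict V) = ⊤ := by
    refine LinearMap.range_eq_top.2 (LinearMap.surjective fun h0 => h ?_)
    simpa using LinearMap.congr_fun h0 ⟨v, hv⟩
  rw [h2, finrank_top, Module.finrank_self, LinearMap.ker_domRestrict] at h1
  rw [← h1, add_comm, ← Submodule.map_comap_subtype, Submodule.finrank_map_subtype_eq]

end BinaryCode

/-! ### Sums of few words -/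

namespace BitSlice

/-- Every sum of `x` and at most `n` words of the list has weight at least `16`, the number of
words included. -/
def SumsHeavy (x : ℕ) (rows : List ℕ) (n : ℕ) : Prop :=
  ∀ U : List ℕ, U.Sublist rows → U.length ≤ n →
    16 ≤ weight (U.foldl (· ^^^ ·) x ^^^ padding U.length)

theorem sumsHeavy_five {x : ℕ} {rows : List ℕ}
    (h : scanSmall (rows.map vec) (start x) = true) : SumsHeavy x rows 5 := fun U hU hl =>
  scanSmall_sound rows (P := []) rfl (coversFrom_start x) h U hU hl

theorem sumsHeavy_six {x : ℕ} {rows : List ℕ} {pairs : Bool} (h5 : SumsHeavy x rows 5)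
    (h : ∀ n < rows.length, ∃ lo hi, lo ≤ n ∧ n ≤ hi ∧
      scan pairs lo hi (rows.map vec) 0 (start x) = true) : SumsHeavy x rows 6 := by
  intro U hU hl
  rcases Nat.lt_or_ge U.length 6 with h' | h'
  · exact h5 U hU (by omega)
  · obtain ⟨U₁, U₂, rfl, hl₁⟩ : ∃ U₁ U₂, U = U₁ ++ U₂ ∧ U₁.length = 5 :=
      ⟨U.take 5, U.drop 5, (List.take_append_drop 5 U).symm, by simp; omega⟩
    obtain ⟨r, rfl⟩ : ∃ r, U₂ = [r] := List.length_eq_one_iff.1 (by simp at h' hl; omega)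
    obtain ⟨R₁, R₂, rfl, h1, h2⟩ := List.append_sublist_iff.1 hU
    obtain ⟨S₁, S₂, rfl⟩ := List.append_of_mem (List.singleton_sublist.1 h2)
    obtain ⟨lo, hi, hlo, hhi, hs⟩ := h (R₁ ++ S₁).length (by simp)
    have := (scan_sound _ (P := []) rfl (coversFrom_start x) hs (R₁ ++ S₁) r S₂ (by simp) hlo hhi
      U₁ (h1.trans (List.sublist_append_left _ _)) hl₁).1
    rw [List.foldl_append]
    simpa [hl₁] using this

theorem sumsHeavy_seven {x : ℕ} {rows : List ℕ} (h6 : SumsHeavy x rows 6)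
    (h : ∀ n < rows.length, ∃ lo hi, lo ≤ n ∧ n ≤ hi ∧
      scan true lo hi (rows.map vec) 0 (start x) = true) : SumsHeavy x rows 7 := by
  intro U hU hl
  rcases Nat.lt_or_ge U.length 7 with h' | h'
  · exact h6 U hU (by omega)
  · obtain ⟨U₁, U₂, rfl, hl₁⟩ : ∃ U₁ U₂, U = U₁ ++ U₂ ∧ U₁.length = 5 :=
      ⟨U.take 5, U.drop 5, (List.take_append_drop 5 U).symm, by simp; omega⟩
    obtain ⟨r, r', rfl⟩ : ∃ r r', U₂ = [r, r'] :=
      List.length_eq_two.1 (by simp at h' hl; omega)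
    obtain ⟨R₁, R₂, rfl, h1, h2⟩ := List.append_sublist_iff.1 hU
    obtain ⟨Q₁, Q₂, rfl, h3, h4⟩ := List.cons_sublist_iff.1 h2
    obtain ⟨S₁, S₂, rfl⟩ := List.append_of_mem h3
    obtain ⟨lo, hi, hlo, hhi, hs⟩ := h (R₁ ++ S₁).length (by simp)
    have := (scan_sound _ (P := []) rfl (coversFrom_start x) hs (R₁ ++ S₁) r (S₂ ++ Q₂) (by simp)
      hlo hhi U₁ (h1.trans (List.sublist_append_left _ _)) hl₁).2 rfl r'
      (List.mem_append_right _ (List.singleton_sublist.1 h4))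
    rw [Nat.xor_right_comm] at this
    rw [List.foldl_append]
    simpa [hl₁] using this

theorem padding_eq (s : ℕ) : padding s = (2 ^ s - 1) <<< 56 := (Nat.shiftLeft_eq _ _).symm

theorem padding_testBit_of_lt {s j : ℕ} (hj : j < 56) : (padding s).testBit j = false := by
  rw [padding_eq, Nat.testBit_shiftLeft, decide_eq_false (Nat.not_le.2 hj), Bool.false_and]

theorem weight_xor_padding {w s : ℕ} (hw : w < 2 ^ 56) (hs : s ≤ 7) :
    weight (w ^^^ padding s) = (∑ j ∈ Finset.range 56, (w.testBit j).toNat) + s := by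
  rw [weight, ← Finset.sum_range_add_sum_Ico _ (show 56 ≤ 63 by norm_num)]
  refine congrArg₂ (· + ·) ?_ ?_
  · refine Finset.sum_congr rfl fun j hj => ?_
    rw [Nat.testBit_xor, padding_testBit_of_lt (Finset.mem_range.1 hj), Bool.xor_false]
  · have h : ∀ j ∈ Finset.Ico 56 63,
        ((w ^^^ padding s).testBit j).toNat = if j < 56 + s then 1 else 0 := by
      intro j hj
      rw [Finset.mem_Ico] at hj
      have h1 : w.testBit j = false :=
        Nat.testBit_lt_two_pow (hw.trans_le (Nat.pow_le_pow_right (by norm_num) hj.1))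
      rw [Nat.testBit_xor, h1, padding_eq, Nat.testBit_shiftLeft,
        Nat.testBit_two_pow_sub_one]
      have h2 : (j - 56 < s) ↔ j < 56 + s := by omega
      by_cases h3 : j < 56 + s <;> simp [hj.1, h2, h3]
    rw [Finset.sum_congr rfl h]
    interval_cases s <;> rfl

theorem foldl_xor_lt {L : List ℕ} {N : ℕ} (hL : ∀ y ∈ L, y < 2 ^ N) : ∀ {x : ℕ}, x < 2 ^ N →
    L.foldl (· ^^^ ·) x < 2 ^ N := by
  induction L with
  | nil => intro x hx; exact hx
  | cons y L ih =>
    intro x hx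
    exact ih (fun z hz => hL z (List.mem_cons_of_mem _ hz))
      (Nat.xor_lt_two_pow hx (hL y List.mem_cons_self))

theorem testBit_foldl_xor {ι : Type*} {f : ι → ℕ} {g : ι → ZMod 2} {j : ℕ}
    (h : ∀ i, (f i).testBit j = decide (g i = 1)) (L : List ι) : ∀ {x : ℕ} {c : ZMod 2},
    x.testBit j = decide (c = 1) →
      ((L.map f).foldl (· ^^^ ·) x).testBit j = decide (c + (L.map g).sum = 1) := by
  induction L with
  | nil => intro x c hx; simpa using hx
  | cons i L ih =>
    intro x c hx
    have : (x ^^^ f i).testBit j = decide (c + g i = 1) := by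
      rw [Nat.testBit_xor, hx, h]
      exact (show ∀ c d : ZMod 2, (decide (c = 1) ^^ decide (d = 1)) = decide (c + d = 1) by
        decide) c (g i)
    rw [List.map_cons, List.foldl_cons, ih this, List.map_cons, List.sum_cons, add_assoc]

end BitSlice

namespace BinaryCode

open BitSlice

/-! ### Four-circulant codes of length 112 -/

/-- The vector of length 28 whose entries are the binary digits of a number, the lowest first. -/
def bits (x : ℕ) : Fin 28 → ZMod 2 := fun i => if x.testBit i then 1 else 0

/-- The cyclic shift of a number of 28 binary digits. -/
def rot (x k : ℕ) : ℕ :=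
  Nat.land (Nat.lor (Nat.shiftLeft x k) (Nat.shiftRight x (Nat.sub 28 k))) 268435455

theorem testBit_rot {x : ℕ} (hx : x < 2 ^ 28) (k j : Fin 28) :
    (rot x k).testBit j = x.testBit (j - k : Fin 28) := by
  have h1 : rot x k = ((x <<< (k : ℕ)) ||| (x >>> (28 - (k : ℕ)))) &&& (2 ^ 28 - 1) := rfl
  rw [h1, Nat.testBit_and, Nat.testBit_two_pow_sub_one, Nat.testBit_or, Nat.testBit_shiftLeft,
    Nat.testBit_shiftRight, Fin.val_sub]
  simp only [j.2, decide_true, Bool.and_true]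
  have hk := k.2
  have hj := j.2
  rcases Nat.lt_or_ge j k with h | h
  · rw [Nat.mod_eq_of_lt (by omega)]
    simp [show ¬ (k : ℕ) ≤ j by omega]
  · rw [show 28 - (k : ℕ) + j = (j - k) + 28 by omega, Nat.add_mod_right,
      Nat.mod_eq_of_lt (by omega)]
    have : x.testBit ((j : ℕ) - k + 28) = false :=
      Nat.testBit_lt_two_pow (hx.trans_le (Nat.pow_le_pow_right (by norm_num) (by omega)))
    simp [h, this]

theorem rot_lt (x k : ℕ) : rot x k < 2 ^ 28 :=
  Nat.lt_of_le_of_lt (Nat.and_le_right) (by norm_num)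

/-- `x'` is the reversal of `x` as a word of 28 binary digits read cyclically. -/
def IsReversal (x x' : ℕ) : Prop :=
  x < 2 ^ 28 ∧ x' < 2 ^ 28 ∧ ∀ i : Fin 28, x'.testBit i = x.testBit (-i : Fin 28)

theorem IsReversal.symm {x x' : ℕ} (h : IsReversal x x') : IsReversal x' x :=
  ⟨h.2.1, h.1, fun i => by rw [h.2.2, neg_neg]⟩

theorem IsReversal.bits_eq {x x' : ℕ} (h : IsReversal x x') : bits x' = fun i => bits x (-i) := by
  funext i
  simp only [bits, h.2.2]

/-- The rows of `rightBlock (bits a) (bits b)` as numbers, where `a'` and `b'` are the reversals of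
`a` and `b`. -/
def row (a b a' b' : ℕ) : Fin 28 ⊕ Fin 28 → ℕ :=
  Sum.elim (fun i => Nat.lor (rot a i) (Nat.shiftLeft (rot b i) 28))
    (fun i => Nat.lor (rot b' i) (Nat.shiftLeft (rot a' i) 28))

/-- The position of a column of `rightBlock` in the numbers `row a b a' b' i`. -/
def pos : Fin 28 ⊕ Fin 28 → ℕ := Sum.elim (fun j => j) (fun j => 28 + j)

theorem testBit_or_shiftLeft_pos {x y : ℕ} (hx : x < 2 ^ 28) (j : Fin 28 ⊕ Fin 28) :
    (x ||| (y <<< 28)).testBit (pos j) = Sum.elim (fun j : Fin 28 => x.testBit j)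
      (fun j : Fin 28 => y.testBit j) j := by
  rcases j with j | j
  · simp [pos, Nat.testBit_or, Nat.testBit_shiftLeft]
  · have : x.testBit (28 + j) = false :=
      Nat.testBit_lt_two_pow (hx.trans_le (Nat.pow_le_pow_right (by norm_num) (by omega)))
    simp [pos, Nat.testBit_or, Nat.testBit_shiftLeft, this]

theorem bits_eq_one (x : ℕ) (i : Fin 28) : decide (bits x i = 1) = x.testBit i := by
  unfold bits
  cases x.testBit i <;> simp

theorem testBit_row {a b a' b' : ℕ} (ha : IsReversal a a') (hb : IsReversal b b')
    (i j : Fin 28 ⊕ Fin 28) :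
    (row a b a' b' i).testBit (pos j) = decide (rightBlock (bits a) (bits b) i j = 1) := by
  rcases i with i | i
  · refine (testBit_or_shiftLeft_pos (rot_lt _ _) j).trans ?_
    rcases j with j | j
    · simp only [Sum.elim_inl, testBit_rot ha.1, rightBlock, Matrix.fromBlocks_apply₁₁,
        rowCirculant_apply]
      exact (bits_eq_one _ _).symm
    · simp only [Sum.elim_inr, testBit_rot hb.1, rightBlock, Matrix.fromBlocks_apply₁₂,
        rowCirculant_apply]
      exact (bits_eq_one _ _).symm
  · refine (testBit_or_shiftLeft_pos (rot_lt _ _) j).trans ?_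
    rcases j with j | j
    · simp only [Sum.elim_inl, testBit_rot hb.2.1, rightBlock, Matrix.fromBlocks_apply₂₁,
        Matrix.transpose_apply, rowCirculant_apply, hb.2.2, neg_sub]
      exact (bits_eq_one _ _).symm
    · simp only [Sum.elim_inr, testBit_rot ha.2.1, rightBlock, Matrix.fromBlocks_apply₂₂,
        Matrix.transpose_apply, rowCirculant_apply, ha.2.2, neg_sub]
      exact (bits_eq_one _ _).symm

theorem row_lt (a b a' b' : ℕ) (i : Fin 28 ⊕ Fin 28) : row a b a' b' i < 2 ^ 56 := by
  have key : ∀ x y k l : ℕ, rot x k ||| (rot y l <<< 28) < 2 ^ 56 := by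
    intro x y k l
    refine Nat.or_lt_two_pow ((rot_lt x k).trans (by norm_num)) ?_
    rw [Nat.shiftLeft_eq]
    have := rot_lt y l
    omega
  rcases i with i | i
  · exact key _ _ _ _
  · exact key _ _ _ _

/-- All row numbers with the exception of the first four. -/
def laterRows : List (Fin 28 ⊕ Fin 28) :=
  ((List.finRange 28).drop 4).map Sum.inl ++ (List.finRange 28).map Sum.inr

theorem sum_eq_sum_laterRows {M : Type*} [AddCommMonoid M] (f : Fin 28 ⊕ Fin 28 → M) :
    ∑ i, f i = f (Sum.inl 0) + f (Sum.inl 1) + f (Sum.inl 2) + f (Sum.inl 3) +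
      (laterRows.map f).sum := by
  have h1 : (Finset.univ : Finset (Fin 28 ⊕ Fin 28)) =
      ([Sum.inl 0, Sum.inl 1, Sum.inl 2, Sum.inl 3] ++ laterRows).toFinset := by decide
  have h2 : ([Sum.inl 0, Sum.inl 1, Sum.inl 2, Sum.inl 3] ++ laterRows).Nodup := by decide
  rw [h1, List.sum_toFinset f h2, List.map_append, List.sum_append]
  simp [add_assoc]

theorem sum_filter_ne_zero {ι M : Type*} [AddCommMonoid M] (u : ι → ZMod 2)
    (f : ι → M) (L : List ι) :
    ((L.filter fun i => u i ≠ 0).map f).sum = (L.map fun i => if u i ≠ 0 then f i else 0).sum := by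
  induction L with
  | nil => rfl
  | cons i L ih =>
    rw [List.map_cons, List.sum_cons, ← ih]
    by_cases h : u i = 0 <;> simp [h]

theorem sum_testBit_eq_hammingNorm {y : ℕ} {v : Fin 28 ⊕ Fin 28 → ZMod 2}
    (h : ∀ j, y.testBit (pos j) = decide (v j = 1)) :
    (∑ j ∈ Finset.range 56, (y.testBit j).toNat) = hammingNorm v := by
  have key : ∀ c : ZMod 2, (decide (c = 1)).toNat = if c ≠ 0 then 1 else 0 := by decide
  rw [hammingNorm_eq_sum, Fintype.sum_sum_type]
  refine (Finset.sum_range_add (fun j => (y.testBit j).toNat) 28 28).trans ?_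
  rw [Finset.sum_range, Finset.sum_range]
  refine congrArg₂ (· + ·) (Finset.sum_congr rfl fun j _ => ?_)
    (Finset.sum_congr rfl fun j _ => ?_)
  · rw [← key, ← h]; rfl
  · rw [← key, ← h]; rfl

/-- The bit-sliced check bounds the weights of the words whose left half contains the first
coordinate of a block and none of the next three. -/
theorem weight_ge_of_sumsHeavy {a b a' b' n : ℕ} (ha : IsReversal a a') (hb : IsReversal b b')
    (hn : n ≤ 7)
    (h : SumsHeavy (row a b a' b' (Sum.inl 0)) (laterRows.map (row a b a' b')) n)
    {u : Fin 28 ⊕ Fin 28 → ZMod 2} (h0 : u (Sum.inl 0) = 1) (h1 : u (Sum.inl 1) = 0)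
    (h2 : u (Sum.inl 2) = 0) (h3 : u (Sum.inl 3) = 0) (hu : hammingNorm u ≤ n + 1) :
    17 ≤ hammingNorm u + hammingNorm (Matrix.vecMul u (rightBlock (bits a) (bits b))) := by
  set L := laterRows.filter fun i => u i ≠ 0 with hL
  have hnorm : hammingNorm u = 1 + L.length := by
    rw [hammingNorm_eq_sum, sum_eq_sum_laterRows, h0, h1, h2, h3, ← sum_filter_ne_zero]
    simp [hL]
  have hsub : (L.map (row a b a' b')).Sublist (laterRows.map (row a b a' b')) :=
    List.filter_sublist.map _
  have h4 := h _ hsub (by simp; omega)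
  have h5 : (∑ j ∈ Finset.range 56, (((L.map (row a b a' b')).foldl (· ^^^ ·)
      (row a b a' b' (Sum.inl 0))).testBit j).toNat) =
      hammingNorm (Matrix.vecMul u (rightBlock (bits a) (bits b))) := by
    refine sum_testBit_eq_hammingNorm fun j => ?_
    rw [testBit_foldl_xor (fun i => testBit_row ha hb i j) L (testBit_row ha hb _ j)]
    refine congrArg (fun c : ZMod 2 => decide (c = 1)) ?_
    simp only [Matrix.vecMul, dotProduct]
    rw [sum_eq_sum_laterRows, h0, h1, h2, h3, hL, sum_filter_ne_zero]
    simp only [one_mul, zero_mul, add_zero]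
    refine congrArg (fun l => _ + List.sum l) (List.map_congr_left fun i _ => ?_)
    rcases (show ∀ c : ZMod 2, c = 0 ∨ c = 1 by decide) (u i) with h | h <;> simp [h]
  have h6 : ∀ y ∈ L.map (row a b a' b'), y < 2 ^ 56 := by
    intro y hy
    obtain ⟨i, -, rfl⟩ := List.mem_map.1 hy
    exact row_lt _ _ _ _ _
  rw [List.length_map, weight_xor_padding (foldl_xor_lt h6 (row_lt _ _ _ _ _)) (by omega), h5] at h4
  rw [hnorm]
  omega

open Fin.CommRing in
/-- A nonempty set of at most eight elements of a cycle of length 28 contains an element that is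
followed by three elements outside the set. -/
theorem exists_gap (u : Fin 28 → ZMod 2) (hu : hammingNorm u ≤ 8) {i : Fin 28} (hi : u i ≠ 0) :
    ∃ k, u k ≠ 0 ∧ u (k + 1) = 0 ∧ u (k + 2) = 0 ∧ u (k + 3) = 0 := by
  by_contra! hcon
  set S : Finset (Fin 28) := Finset.univ.filter fun i => u i ≠ 0 with hS
  have hmem : ∀ k, k ∈ S ↔ u k ≠ 0 := by simp [hS]
  have hcover : ∀ x : Fin 28, x ∈ S ∨ x - 1 ∈ S ∨ x - 2 ∈ S := by
    intro x
    by_contra! hx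
    -- a gap of length three propagates backwards through the whole cycle
    have key : ∀ n : ℕ, ∀ y : Fin 28, x = y + (n : Fin 28) →
        y ∉ S ∧ y - 1 ∉ S ∧ y - 2 ∉ S := by
      intro n
      induction n with
      | zero =>
        rintro y rfl
        simpa using hx
      | succ n ih =>
        intro y hy
        obtain ⟨h0, h1, h2⟩ := ih (y + 1) (by rw [hy]; push_cast; ring)
        rw [show y + 1 - 1 = y by ring] at h1
        rw [show y + 1 - 2 = y - 1 by ring] at h2
        refine ⟨h1, h2, fun h3 => ?_⟩
        have h4 := hcon _ ((hmem _).1 h3)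
        rw [show y - 2 + 1 = y - 1 by ring, show y - 2 + 2 = y by ring,
          show y - 2 + 3 = y + 1 by ring] at h4
        rw [hmem, not_not] at h0 h1 h2
        exact h4 h2 h1 h0
    refine (key (x - i).val i ?_).1 ((hmem _).2 hi)
    rw [Fin.cast_val_eq_self, add_sub_cancel]
  have hle : (Finset.univ : Finset (Fin 28)) ⊆
      S ∪ (S.map (Equiv.addRight 1).toEmbedding ∪ S.map (Equiv.addRight 2).toEmbedding) := by
    intro x _
    simp only [Finset.mem_union, Finset.mem_map_equiv]
    simpa [sub_eq_add_neg] using hcover x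
  have h1 := Finset.card_le_card hle
  have h2 := Finset.card_union_le S
    (S.map (Equiv.addRight 1).toEmbedding ∪ S.map (Equiv.addRight 2).toEmbedding)
  have h3 := Finset.card_union_le (S.map (Equiv.addRight 1).toEmbedding)
    (S.map (Equiv.addRight 2).toEmbedding)
  rw [Finset.card_map, Finset.card_map] at h3
  rw [Finset.card_univ, Fintype.card_fin] at h1
  have h4 : S.card ≤ 8 := hu
  omega

theorem hammingNorm_comp_inl_le {ι κ : Type*} [Fintype ι] [Fintype κ] (u : ι ⊕ κ → ZMod 2) :
    hammingNorm (fun i => u (Sum.inl i)) ≤ hammingNorm u := by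
  rw [hammingNorm_eq_sum, hammingNorm_eq_sum, Fintype.sum_sum_type]
  exact Nat.le_add_right _ _

theorem seventeen_le_hammingNorm {a b a' b' n : ℕ} (ha : IsReversal a a') (hb : IsReversal b b')
    (hn : n ≤ 7)
    (h : SumsHeavy (row a b a' b' (Sum.inl 0)) (laterRows.map (row a b a' b')) n)
    {v : Fin 112 → ZMod 2} (hv : v ∈ fourCirculantCode (bits a) (bits b))
    (h0 : left (m := 28) v ≠ 0) (hl : hammingNorm (left (m := 28) v) ≤ n + 1) :
    17 ≤ hammingNorm v := by
  -- it suffices to find a symmetry of the code after which the left half has the required form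
  have key : ∀ π : Equiv.Perm (Fin 28 ⊕ Fin 28),
      (∀ i j, rightBlock (bits a) (bits b) (π i) (π j) = rightBlock (bits a) (bits b) i j) →
      left (m := 28) v (π (Sum.inl 0)) ≠ 0 → left (m := 28) v (π (Sum.inl 1)) = 0 →
      left (m := 28) v (π (Sum.inl 2)) = 0 → left (m := 28) v (π (Sum.inl 3)) = 0 →
      17 ≤ hammingNorm v := by
    intro π hπ e0 e1 e2 e3
    have hw := comp_relabel_mem hπ hv
    rw [mem_fourCirculantCode, left_comp_relabel] at hw
    have e0' : left (m := 28) v (π (Sum.inl 0)) = 1 := by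
      revert e0
      generalize left (m := 28) v (π (Sum.inl 0)) = c
      revert c
      decide
    have := weight_ge_of_sumsHeavy ha hb hn h (u := fun i => left (m := 28) v (π i)) e0' e1 e2 e3
      (by rwa [hammingNorm_comp_equiv])
    rwa [← hw, right_comp_relabel, hammingNorm_comp_equiv, hammingNorm_comp_equiv,
      ← hammingNorm_eq_halves] at this
  have key' : ∀ π : Equiv.Perm (Fin 28 ⊕ Fin 28),
      (∀ i j, rightBlock (bits a) (bits b) (π i) (π j) = rightBlock (bits a) (bits b) i j) →
      ∀ i, left (m := 28) v (π (Sum.inl i)) ≠ 0 → 17 ≤ hammingNorm v := by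
    intro π hπ i hi
    obtain ⟨k, k0, k1, k2, k3⟩ := exists_gap (fun i => left (m := 28) v (π (Sum.inl i)))
      ((hammingNorm_comp_inl_le (fun i => left (m := 28) v (π i))).trans
        (by rw [hammingNorm_comp_equiv]; omega)) hi
    refine key ((rotation k).trans π) (fun i j => ?_) ?_ ?_ ?_ ?_
    · rw [Equiv.trans_apply, Equiv.trans_apply, hπ, rightBlock_rotation]
    · simpa [rotation] using k0
    · simpa [rotation, add_comm] using k1
    · simpa [rotation, add_comm] using k2
    · simpa [rotation, add_comm] using k3
  obtain ⟨i, hi⟩ := Function.ne_iff.1 h0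
  rcases i with i | i
  · exact key' (Equiv.refl _) (fun _ _ => rfl) i hi
  · refine key' reflection (rightBlock_reflection _ _) (-i) ?_
    simpa [reflection] using hi

/-- The criterion for extremality: a word of weight at most `16` has at most `8` ones in its left
half or at most `7` ones in its right half. -/
theorem isExtremal_of_sumsHeavy {a b a' b' : ℕ} (ha : IsReversal a a') (hb : IsReversal b b')
    (horth : rightBlock (bits a) (bits b) * (rightBlock (bits a) (bits b)).transpose = 1)
    (hw : 4 ∣ 1 + (hammingNorm (bits a) + hammingNorm (bits b)))
    (hl : SumsHeavy (row a b a' b' (Sum.inl 0)) (laterRows.map (row a b a' b')) 7)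
    (hr : SumsHeavy (row a' b a b' (Sum.inl 0)) (laterRows.map (row a' b a b')) 6)
    (hex : ∃ v ∈ (fourCirculantCode (bits a) (bits b) : BinaryCode 112), hammingNorm v = 20) :
    (fourCirculantCode (bits a) (bits b) : BinaryCode 112).IsExtremalDoublyEvenSelfDual := by
  have hde := isDoublyEvenSelfDual_of horth hw
  refine ⟨hde, ?_, ?_⟩
  · obtain ⟨v, hv, h20⟩ := hex
    refine ⟨v, hv, ?_, h20⟩
    rintro rfl
    simp at h20
  · rintro w ⟨v, hv, hne, rfl⟩
    have h4 : 4 ∣ hammingNorm v := hde.2 v hv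
    by_contra hlt
    have hlt' : hammingNorm v < 20 := by simpa using hlt
    have hle : hammingNorm v ≤ 16 := by omega
    have hsum := hammingNorm_eq_halves (m := 28) v
    rcases Nat.lt_or_ge (hammingNorm (left (m := 28) v)) 9 with h8 | h9
    · have h0 : left (m := 28) v ≠ 0 := by
        intro h0
        refine hne (ext_halves (m := 28) h0 ?_)
        rw [mem_fourCirculantCode.1 hv, h0, Matrix.zero_vecMul]
        rfl
      have := seventeen_le_hammingNorm ha hb le_rfl hl hv h0 (by omega)
      omega
    · have hv' := glue_right_left_mem horth hv
      rw [← ha.bits_eq] at hv'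
      have h0 : right (m := 28) v ≠ 0 := by
        intro h0
        have h1 := mem_fourCirculantCode.1 hv'
        rw [left_glue, right_glue, h0, Matrix.zero_vecMul] at h1
        rw [h1] at h9
        simp at h9
      have := seventeen_le_hammingNorm ha.symm hb (by norm_num) hr hv'
        (by rwa [left_glue]) (by rw [left_glue]; omega)
      rw [hammingNorm_eq_halves (m := 28), left_glue, right_glue] at this
      omega

end BinaryCode

namespace BinaryCode

open BitSlice

/-! ### The exhaustive check -/

/-- The words of the check of `isExtremal_of_sumsHeavy` that are added to the word `leading`. -/
noncomputable def summands (a b a' b' : ℕ) : List BTree :=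
  (laterRows.map (row a b a' b')).map vec

/-- The families at the start of the check. -/
noncomputable def leading (a b a' b' : ℕ) : List Family := start (row a b a' b' (Sum.inl 0))

/-- The check of all sums of at most six words. The scan is cut into intervals so that each
evaluation needs a moderate amount of memory. -/
structure CheckSix (a b a' b' : ℕ) : Prop where
  small : scanSmall (summands a b a' b') (leading a b a' b') = true
  upTo47 : scan false 0 47 (summands a b a' b') 0 (leading a b a' b') = true
  upTo51 : scan false 48 51 (summands a b a' b') 0 (leading a b a' b') = true

/-- The check of all sums of at most seven words, cut into intervals of similar cost. -/
structure CheckSeven (a b a' b' : ℕ) : Prop where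
  small : scanSmall (summands a b a' b') (leading a b a' b') = true
  upTo30 : scan true 0 30 (summands a b a' b') 0 (leading a b a' b') = true
  upTo34 : scan true 31 34 (summands a b a' b') 0 (leading a b a' b') = true
  upTo37 : scan true 35 37 (summands a b a' b') 0 (leading a b a' b') = true
  upTo39 : scan true 38 39 (summands a b a' b') 0 (leading a b a' b') = true
  upTo41 : scan true 40 41 (summands a b a' b') 0 (leading a b a' b') = true
  upTo43 : scan true 42 43 (summands a b a' b') 0 (leading a b a' b') = true
  upTo45 : scan true 44 45 (summands a b a' b') 0 (leading a b a' b') = true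
  upTo48 : scan true 46 48 (summands a b a' b') 0 (leading a b a' b') = true
  upTo51 : scan true 49 51 (summands a b a' b') 0 (leading a b a' b') = true

theorem CheckSix.sumsHeavy {a b a' b' : ℕ} (h : CheckSix a b a' b') :
    SumsHeavy (row a b a' b' (Sum.inl 0)) (laterRows.map (row a b a' b')) 6 := by
  refine sumsHeavy_six (pairs := false) (sumsHeavy_five h.small) fun n hn => ?_
  have hn : n < 52 := by simpa [laterRows] using hn
  rcases Nat.lt_or_ge n 48 with h1 | h1
  · exact ⟨0, 47, n.zero_le, by omega, h.upTo47⟩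
  · exact ⟨48, 51, h1, by omega, h.upTo51⟩

theorem CheckSeven.sumsHeavy {a b a' b' : ℕ} (h : CheckSeven a b a' b') :
    SumsHeavy (row a b a' b' (Sum.inl 0)) (laterRows.map (row a b a' b')) 7 := by
  have key : ∀ n < (laterRows.map (row a b a' b')).length, ∃ lo hi, lo ≤ n ∧ n ≤ hi ∧
      scan true lo hi (summands a b a' b') 0 (leading a b a' b') = true := by
    intro n hn
    have hn : n < 52 := by simpa [laterRows] using hn
    rcases Nat.lt_or_ge n 31 with h1 | h1
    · exact ⟨_, _, n.zero_le, by omega, h.upTo30⟩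
    rcases Nat.lt_or_ge n 35 with h2 | h2
    · exact ⟨_, _, h1, by omega, h.upTo34⟩
    rcases Nat.lt_or_ge n 38 with h3 | h3
    · exact ⟨_, _, h2, by omega, h.upTo37⟩
    rcases Nat.lt_or_ge n 40 with h4 | h4
    · exact ⟨_, _, h3, by omega, h.upTo39⟩
    rcases Nat.lt_or_ge n 42 with h5 | h5
    · exact ⟨_, _, h4, by omega, h.upTo41⟩
    rcases Nat.lt_or_ge n 44 with h6 | h6
    · exact ⟨_, _, h5, by omega, h.upTo43⟩
    rcases Nat.lt_or_ge n 46 with h7 | h7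
    · exact ⟨_, _, h6, by omega, h.upTo45⟩
    rcases Nat.lt_or_ge n 49 with h8 | h8
    · exact ⟨_, _, h7, by omega, h.upTo48⟩
    · exact ⟨_, _, h8, by omega, h.upTo51⟩
  exact sumsHeavy_seven (sumsHeavy_six (pairs := true) (sumsHeavy_five h.small) key) key

/-- First rows `bits a` and `bits b` of a doubly even self-dual four-circulant code, together with
their reversals. -/
structure IsDoublyEvenData (a b a' b' : ℕ) : Prop where
  reversal_left : IsReversal a a'
  reversal_right : IsReversal b b'
  orthogonal : ∀ k : Fin 28, ∑ j, (bits a j * bits a (j - k) + bits b j * bits b (j - k)) =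
    if k = 0 then 1 else 0
  four_dvd : 4 ∣ 1 + (hammingNorm (bits a) + hammingNorm (bits b))

theorem hammingNorm_glue (l r : Fin 28 ⊕ Fin 28 → ZMod 2) :
    hammingNorm (glue l r) = hammingNorm l + hammingNorm r := by
  rw [hammingNorm_eq_halves, left_glue, right_glue]

theorem IsDoublyEvenData.isExtremal {a b a' b' : ℕ} (h : IsDoublyEvenData a b a' b')
    (hl : CheckSeven a b a' b') (hr : CheckSix a' b a b') (c : Fin 28 ⊕ Fin 28 → ZMod 2)
    (hc : hammingNorm c + hammingNorm (Matrix.vecMul c (rightBlock (bits a) (bits b))) = 20) :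
    (fourCirculantCode (bits a) (bits b) : BinaryCode 112).IsExtremalDoublyEvenSelfDual :=
  isExtremal_of_sumsHeavy h.reversal_left h.reversal_right
    (rightBlock_mul_transpose h.orthogonal) h.four_dvd hl.sumsHeavy hr.sumsHeavy
    ⟨_, glue_mem _ _ c, (hammingNorm_glue _ _).trans hc⟩

/-! ### The codes `C112`, `D112`, `E112` and `H112` -/

theorem isSinglyEvenSelfDual_of {m : ℕ} [NeZero m] {a b : Fin m → ZMod 2}
    (h : rightBlock a b * (rightBlock a b).transpose = 1)
    (hw : (1 + (hammingNorm a + hammingNorm b)) % 4 = 2) :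
    (fourCirculantCode a b).IsSinglyEvenSelfDual := by
  rw [← hammingNorm_generator a b (Sum.inl 0)] at hw
  exact ⟨isSelfDual_of_mul_transpose h, _, glue_mem _ _ _, hw⟩

theorem C112_eq : C112 = fourCirculantCode (bits 95925921) (bits 135553476) :=
  congrArg₂ (fourCirculantCode (m := 28)) (by decide +kernel) (by decide +kernel)

/-- The first rows of `D112` are the complements of those of `C112`. -/
theorem D112_eq : D112 = fourCirculantCode (bits 172509534) (bits 132881979) := by
  have ha : bits 172509534 = 1 + bits 95925921 := by decide +kernel
  have hb : bits 132881979 = 1 + bits 135553476 := by decide +kernel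
  rw [D112, C112_eq, ha, hb]
  refine inf_dual_sup_span_eq (m := 28) (by decide +kernel) ?_ (by decide +kernel)
  rw [← ha, ← hb]
  exact mem_fourCirculantCode.2 (by decide +kernel)

theorem E112_eq : E112 = fourCirculantCode (bits 188616961) (bits 128685150) :=
  congrArg₂ (fourCirculantCode (m := 28)) (by decide +kernel) (by decide +kernel)

/-- A third extremal doubly even four-circulant code of length 112. Its first rows are the binary
digits of the two numbers, the lowest first. -/
def H112 : BinaryCode 112 := fourCirculantCode (bits 18036457) (bits 234591883)

theorem isDoublyEvenData_D : IsDoublyEvenData 172509534 132881979 257049162 193936125 where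
  reversal_left := ⟨by norm_num, by norm_num, by decide +kernel⟩
  reversal_right := ⟨by norm_num, by norm_num, by decide +kernel⟩
  orthogonal := by decide +kernel
  four_dvd := by decide +kernel

theorem isDoublyEvenData_E : IsDoublyEvenData 188616961 128685150 1118107 256195260 where
  reversal_left := ⟨by norm_num, by norm_num, by decide +kernel⟩
  reversal_right := ⟨by norm_num, by norm_num, by decide +kernel⟩
  orthogonal := by decide +kernel
  four_dvd := by decide +kernel

theorem isDoublyEvenData_H : IsDoublyEvenData 18036457 234591883 49125649 170736631 where
  reversal_left := ⟨by norm_num, by norm_num, by decide +kernel⟩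
  reversal_right := ⟨by norm_num, by norm_num, by decide +kernel⟩
  orthogonal := by decide +kernel
  four_dvd := by decide +kernel

set_option maxHeartbeats 0 in
-- All evaluations are conjuncts of one theorem, so that they run one after the other.
/-- The exhaustive check for `D112`, `E112` and `H112`. The check of six words concerns the codes
with interchanged halves, whose first row `a` is reversed. -/
theorem checks :
    (CheckSeven 172509534 132881979 257049162 193936125 ∧
      CheckSix 257049162 132881979 172509534 193936125) ∧
    (CheckSeven 188616961 128685150 1118107 256195260 ∧
      CheckSix 1118107 128685150 188616961 256195260) ∧
    (CheckSeven 18036457 234591883 49125649 170736631 ∧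
      CheckSix 49125649 234591883 18036457 170736631) := by
  refine ⟨⟨?_, ?_⟩, ⟨?_, ?_⟩, ⟨?_, ?_⟩⟩ <;> constructor <;> decide +kernel

theorem D112_isExtremal : D112.IsExtremalDoublyEvenSelfDual := by
  rw [D112_eq]
  exact isDoublyEvenData_D.isExtremal checks.1.1 checks.1.2
    (Sum.elim (bits 1) (bits 8388608)) (by decide +kernel)

theorem E112_isExtremal : E112.IsExtremalDoublyEvenSelfDual := by
  rw [E112_eq]
  exact isDoublyEvenData_E.isExtremal checks.2.1.1 checks.2.1.2
    (Sum.elim (bits 131075) (bits 0)) (by decide +kernel)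

theorem H112_isExtremal : H112.IsExtremalDoublyEvenSelfDual := by
  rw [H112]
  exact isDoublyEvenData_H.isExtremal checks.2.2.1 checks.2.2.2
    (Sum.elim (bits 129) (bits 0)) (by decide +kernel)

theorem C112_mul_transpose : rightBlock (bits 95925921) (bits 135553476) *
    (rightBlock (bits 95925921) (bits 135553476)).transpose = 1 :=
  rightBlock_mul_transpose (by decide +kernel)

theorem C112_isSinglyEvenSelfDual : C112.IsSinglyEvenSelfDual := by
  rw [C112_eq]
  exact isSinglyEvenSelfDual_of (m := 28) C112_mul_transpose (by decide +kernel)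

/-- `C112` and `D112` share the codewords of `C112` whose left half has even weight. -/
theorem C112_inf_D112 : (C112 ⊓ D112 : BinaryCode 112) =
    C112 ⊓ LinearMap.ker (∑ i, LinearMap.proj (fourBlockEquiv 28 (Sum.inl i)) :
      (Fin 112 → ZMod 2) →ₗ[ZMod 2] ZMod 2) := by
  have ha : bits 172509534 = 1 + bits 95925921 := by decide +kernel
  have hb : bits 132881979 = 1 + bits 135553476 := by decide +kernel
  have hker : ∀ v : Fin 112 → ZMod 2,
      v ∈ LinearMap.ker (∑ i, LinearMap.proj (fourBlockEquiv 28 (Sum.inl i)) :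
        (Fin 112 → ZMod 2) →ₗ[ZMod 2] ZMod 2) ↔ ∑ i, left (m := 28) v i = 0 := by
    intro v
    rw [LinearMap.mem_ker, LinearMap.sum_apply]
    rfl
  rw [D112_eq, C112_eq, ha, hb]
  ext v
  rw [Submodule.mem_inf, Submodule.mem_inf, hker]
  refine and_congr_right fun hv => ⟨fun hv' => ?_, fun h => (mem_complement_iff h).2 hv⟩
  exact sum_left_eq_zero_of_mem hv hv'

theorem C112_areNeighbors_D112 : C112.AreNeighbors D112 := by
  refine ⟨C112_isSinglyEvenSelfDual.1, D112_isExtremal.1.1, ?_⟩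
  have h1 : Module.finrank (ZMod 2) C112 = 56 := by
    rw [C112_eq]
    exact finrank_fourCirculantCode (m := 28) _ _
  rw [C112_inf_D112]
  refine Nat.eq_sub_of_add_eq ((finrank_inf_ker_add_one C112 _
    (v := glue (m := 28) (Pi.single (Sum.inl 0) 1) (Matrix.vecMul (Pi.single (Sum.inl 0) 1)
      (rightBlock (bits 95925921) (bits 135553476)))) ?_ ?_).trans h1)
  · rw [C112_eq]
    exact glue_mem _ _ _
  · rw [LinearMap.sum_apply]
    change ∑ i, left (m := 28) (glue _ _) i ≠ 0
    rw [left_glue]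
    simp

end BinaryCode

namespace BinaryCode

/-! ### An invariant of codes -/

section Invariant

variable {n : ℕ}

open Classical in
/-- The codewords of weight `w` such that the codewords that vanish on their support form a space
of dimension `d`. -/
@[irreducible] noncomputable def wordsOfType (C : BinaryCode n) (w d : ℕ) :
    Finset (Fin n → ZMod 2) :=
  Finset.univ.filter fun a => a ∈ C ∧ hammingNorm a = w ∧
    Module.finrank (ZMod 2) (C ⊓ LinearMap.ker (LinearMap.mulLeft (ZMod 2) a) : BinaryCode n) = d

theorem mem_wordsOfType {C : BinaryCode n} {w d : ℕ} {a : Fin n → ZMod 2} :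
    a ∈ wordsOfType C w d ↔ a ∈ C ∧ hammingNorm a = w ∧
      Module.finrank (ZMod 2)
        (C ⊓ LinearMap.ker (LinearMap.mulLeft (ZMod 2) a) : BinaryCode n) = d := by
  simp [wordsOfType]

theorem comp_mem_wordsOfType {C C' : BinaryCode n} {σ : Equiv.Perm (Fin n)}
    (h : C' = C.map (LinearMap.funLeft (ZMod 2) (ZMod 2) σ)) {w d : ℕ} {a : Fin n → ZMod 2} :
    (fun j => a (σ j)) ∈ wordsOfType C' w d ↔ a ∈ wordsOfType C w d := by
  set e : (Fin n → ZMod 2) ≃ₗ[ZMod 2] (Fin n → ZMod 2) :=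
    LinearEquiv.funCongrLeft (ZMod 2) (ZMod 2) σ with he
  have hmem : ∀ v, e v ∈ C' ↔ v ∈ C := by
    intro v
    rw [h]
    exact (Submodule.mem_map_equiv (e := e) C).trans (by rw [LinearEquiv.symm_apply_apply])
  have hker : ∀ v, e v ∈ LinearMap.ker (LinearMap.mulLeft (ZMod 2) (e a)) ↔
      v ∈ LinearMap.ker (LinearMap.mulLeft (ZMod 2) a) := by
    intro v
    rw [LinearMap.mem_ker, LinearMap.mem_ker, LinearMap.mulLeft_apply, LinearMap.mulLeft_apply,
      ← map_eq_zero_iff e e.injective (x := a * v)]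
    rfl
  have hmap : (C' ⊓ LinearMap.ker (LinearMap.mulLeft (ZMod 2) (e a)) : BinaryCode n) =
      (C ⊓ LinearMap.ker (LinearMap.mulLeft (ZMod 2) a) : BinaryCode n).map
        (e : (Fin n → ZMod 2) →ₗ[ZMod 2] (Fin n → ZMod 2)) := by
    ext v
    obtain ⟨u, rfl⟩ := e.surjective v
    rw [Submodule.mem_map_equiv, LinearEquiv.symm_apply_apply, Submodule.mem_inf,
      Submodule.mem_inf, hmem, hker]
  change e a ∈ _ ↔ _
  rw [mem_wordsOfType, mem_wordsOfType, hmem, hmap, LinearEquiv.finrank_map_eq,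
    show hammingNorm (e a) = hammingNorm a from hammingNorm_comp_equiv σ a]

theorem Equivalent.card_wordsOfType_eq {C C' : BinaryCode n} (h : C.Equivalent C') (w d : ℕ) :
    (wordsOfType C w d).card = (wordsOfType C' w d).card := by
  obtain ⟨σ, h⟩ := h
  refine Finset.card_bij (fun a _ j => a (σ j)) (fun a ha => (comp_mem_wordsOfType h).2 ha) ?_ ?_
  · intro a _ b _ hab
    funext j
    simpa using congrFun hab (σ.symm j)
  · intro b hb
    refine ⟨fun j => b (σ.symm j), (comp_mem_wordsOfType h).1 ?_, ?_⟩
    · simpa using hb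
    · simp

end Invariant

theorem card_mod_two_eq_card_fixed {α : Type*} [DecidableEq α] (S : Finset α) (f : α → α)
    (hf : ∀ a ∈ S, f a ∈ S) (hff : ∀ a ∈ S, f (f a) = a) :
    S.card % 2 = (S.filter fun a => f a = a).card % 2 := by
  have h : ((S.filter fun a => ¬ f a = a).card : ZMod 2) = 0 := by
    rw [Finset.card_eq_sum_ones, Nat.cast_sum]
    refine Finset.sum_involution (fun a _ => f a) (fun _ _ => by decide) ?_ ?_ ?_
    · intro a ha _
      exact (Finset.mem_filter.1 ha).2
    · intro a ha
      rw [Finset.mem_filter] at ha ⊢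
      exact ⟨hf a ha.1, fun h => ha.2 (by rw [hff a ha.1] at h; exact h.symm)⟩
    · intro a ha
      exact hff a (Finset.mem_filter.1 ha).1
  rw [ZMod.natCast_eq_zero_iff] at h
  have := S.card_filter_add_card_filter_not (fun a => f a = a)
  omega

/-- The parity of the number of elements of a set of words is the parity of the number of its
elements that are fixed by a dihedral group of order eight acting on the set. -/
theorem card_mod_two_eq_card_fixed_dihedral {ι : Type*} [Fintype ι] [DecidableEq ι]
    (S : Finset (ι → ZMod 2)) (ρ σ : Equiv.Perm ι)
    (hρ : ∀ a ∈ S, (fun i => a (ρ i)) ∈ S) (hσ : ∀ a ∈ S, (fun i => a (σ i)) ∈ S)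
    (h4 : ∀ i, ρ (ρ (ρ (ρ i))) = i) (h2 : ∀ i, σ (σ i) = i) (h : ∀ i, ρ (σ (ρ i)) = σ i) :
    S.card % 2 =
      (S.filter fun a => (fun i => a (ρ i)) = a ∧ (fun i => a (σ i)) = a).card % 2 := by
  set S₁ := S.filter fun a => (fun i => a (ρ (ρ i))) = a with hS₁
  set S₂ := S₁.filter fun a => (fun i => a (ρ i)) = a with hS₂
  have e1 : S.card % 2 = S₁.card % 2 :=
    card_mod_two_eq_card_fixed S (fun a i => a (ρ (ρ i))) (fun a ha => hρ _ (hρ _ ha))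
      (fun a _ => by simp only [h4])
  have e2 : S₁.card % 2 = S₂.card % 2 := by
    refine card_mod_two_eq_card_fixed S₁ (fun a i => a (ρ i)) (fun a ha => ?_)
      (fun a ha => (Finset.mem_filter.1 ha).2)
    rw [hS₁, Finset.mem_filter] at ha ⊢
    exact ⟨hρ _ ha.1, funext fun i => congrFun ha.2 (ρ i)⟩
  have e3 : S₂.card % 2 = (S₂.filter fun a => (fun i => a (σ i)) = a).card % 2 := by
    refine card_mod_two_eq_card_fixed S₂ (fun a i => a (σ i)) (fun a ha => ?_)
      (fun a _ => by simp only [h2])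
    rw [hS₂, hS₁, Finset.mem_filter, Finset.mem_filter] at ha ⊢
    obtain ⟨⟨ha, -⟩, ha'⟩ := ha
    have key : ∀ i, a (σ (ρ i)) = a (σ i) := fun i => by
      rw [← h i]
      exact (congrFun ha' (σ (ρ i))).symm
    exact ⟨⟨hσ _ ha, funext fun i => (key _).trans (key i)⟩, funext key⟩
  rw [e1, e2, e3]
  congr 2
  ext a
  simp only [hS₂, hS₁, Finset.mem_filter]
  constructor
  · rintro ⟨⟨⟨h1, -⟩, h2⟩, h3⟩
    exact ⟨h1, h2, h3⟩
  · rintro ⟨h1, h2, h3⟩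
    exact ⟨⟨⟨h1, funext fun i => (congrFun h2 (ρ i)).trans (congrFun h2 i)⟩, h2⟩, h3⟩

/-! ### Dimensions by elimination -/

/-- The word of length `n` whose entries are the binary digits of a number. -/
def toWord (n : ℕ) (x : ℕ) : Fin n → ZMod 2 := fun j => if x.testBit j then 1 else 0

theorem toWord_xor (n x y : ℕ) : toWord n (x ^^^ y) = toWord n x + toWord n y := by
  funext j
  simp only [toWord, Nat.testBit_xor, Pi.add_apply]
  cases x.testBit j <;> cases y.testBit j <;> decide

theorem toWord_zero (n : ℕ) : toWord n 0 = 0 := by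
  funext j
  simp [toWord]

/-- The digit of `x` at position `j`, as a number. -/
def digit (x j : ℕ) : ℕ := Nat.land (Nat.shiftRight x j) 1

theorem digit_eq (x j : ℕ) : digit x j = (x.testBit j).toNat := by
  change (x >>> j) &&& 1 = _
  rw [Nat.and_one_is_mod, Nat.testBit, Nat.and_comm, Nat.and_one_is_mod]
  rcases Nat.mod_two_eq_zero_or_one (x >>> j) with h | h <;> simp [h]

/-- The first number of a list with a nonzero digit at position `j`, or `0`. -/
def pivot (j : ℕ) (B : List ℕ) : ℕ :=
  List.rec 0 (fun b _ ih => Bool.rec ih b (Nat.beq (digit b j) 1)) B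

/-- Clears position `j` of all words of a list by adding the word `p`. -/
def clear (j p : ℕ) (B : List ℕ) : List ℕ :=
  List.rec [] (fun b _ ih => Nat.xor b (Nat.mul (digit b j) p) :: ih) B

/-- The number of steps of the elimination that find a pivot. -/
def rankOn (J : List ℕ) : List ℕ → ℕ :=
  List.rec (fun _ => 0) (fun j _ ih B =>
    Nat.add (digit (pivot j B) j) (ih (clear j (pivot j B) B))) J

theorem pivot_eq_zero_or_mem (j : ℕ) (B : List ℕ) :
    (pivot j B = 0 ∧ ∀ b ∈ B, b.testBit j = false) ∨
      (pivot j B ∈ B ∧ (pivot j B).testBit j = true) := by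
  induction B with
  | nil => exact Or.inl ⟨rfl, by simp⟩
  | cons b B ih =>
    have h : pivot j (b :: B) = (Bool.rec (pivot j B) b (Nat.beq (digit b j) 1) : ℕ) := rfl
    rw [h, digit_eq]
    cases hb : b.testBit j
    · change (pivot j B = 0 ∧ _) ∨ (pivot j B ∈ _ ∧ _)
      rcases ih with h | h
      · exact Or.inl ⟨h.1, by simpa [hb] using h.2⟩
      · exact Or.inr ⟨List.mem_cons_of_mem _ h.1, h.2⟩
    · exact Or.inr ⟨List.mem_cons_self, hb⟩

theorem clear_eq (j p : ℕ) (B : List ℕ) :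
    clear j p B = B.map fun b => b ^^^ ((b.testBit j).toNat * p) := by
  induction B with
  | nil => rfl
  | cons b B ih =>
    rw [List.map_cons, ← ih, ← digit_eq]
    rfl

/-- The code spanned by the words of a list. -/
def spanWords (n : ℕ) (B : List ℕ) : BinaryCode n :=
  Submodule.span (ZMod 2) (toWord n '' {b | b ∈ B})

/-- The words that vanish at the positions of a list. -/
def vanishing (n : ℕ) (J : List (Fin n)) : BinaryCode n where
  carrier := {v | ∀ j ∈ J, v j = 0}
  zero_mem' := fun _ _ => rfl
  add_mem' := fun {a b} ha hb j hj => by rw [Pi.add_apply, ha j hj, hb j hj, add_zero]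
  smul_mem' := fun c x hx j hj => by rw [Pi.smul_apply, hx j hj, smul_zero]

theorem spanWords_clear {n : ℕ} (j : Fin n) (B : List ℕ) :
    spanWords n (clear j (pivot j B) B) =
        spanWords n B ⊓ LinearMap.ker (LinearMap.proj j : (Fin n → ZMod 2) →ₗ[ZMod 2] ZMod 2) ∧
      Module.finrank (ZMod 2) (spanWords n (clear j (pivot j B) B)) + digit (pivot j B) j =
        Module.finrank (ZMod 2) (spanWords n B) := by
  rcases pivot_eq_zero_or_mem j B with ⟨h0, h1⟩ | ⟨h0, h1⟩
  · have hB : clear j (pivot j B) B = B := by rw [h0, clear_eq]; simp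
    have hle : spanWords n B ≤ LinearMap.ker
        (LinearMap.proj j : (Fin n → ZMod 2) →ₗ[ZMod 2] ZMod 2) := by
      refine Submodule.span_le.2 ?_
      rintro _ ⟨b, hb, rfl⟩
      simp [toWord, h1 b hb]
    rw [hB, h0, inf_eq_left.2 hle, digit_eq]
    simp
  · set p := pivot j B
    have hp : toWord n p ∈ spanWords n B := Submodule.subset_span ⟨p, h0, rfl⟩
    have hpj : toWord n p j = 1 := by simp [toWord, h1]
    -- a step of the elimination is a projection onto the hyperplane
    set T : (Fin n → ZMod 2) →ₗ[ZMod 2] (Fin n → ZMod 2) :=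
      LinearMap.id + (LinearMap.proj j).smulRight (toWord n p) with hT
    have hTv : ∀ v, T v = v + v j • toWord n p := fun v => rfl
    have h2 : spanWords n (clear j p B) = (spanWords n B).map T := by
      rw [spanWords, spanWords, Submodule.map_span, Set.image_image, clear_eq]
      congr 1
      have h3 : ∀ b, toWord n (b ^^^ ((b.testBit j).toNat * p)) = T (toWord n b) := by
        intro b
        rw [toWord_xor, hTv]
        congr 1
        cases hb : b.testBit j <;> simp [toWord, hb, toWord_zero]
      ext v
      simp [h3]
    have h4 : spanWords n (clear j p B) =
        spanWords n B ⊓ LinearMap.ker (LinearMap.proj j : (Fin n → ZMod 2) →ₗ[ZMod 2] ZMod 2) := by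
      rw [h2]
      apply le_antisymm
      · rintro _ ⟨v, hv, rfl⟩
        refine ⟨?_, ?_⟩
        · rw [hTv]
          exact add_mem hv (Submodule.smul_mem _ _ hp)
        · rw [hTv]
          change v j + v j • toWord n p j = 0
          rw [hpj, smul_eq_mul, mul_one, CharTwo.add_self_eq_zero]
      · rintro v ⟨hv, hv'⟩
        have hv' : v j = 0 := hv'
        exact ⟨v, hv, by rw [hTv, hv', zero_smul, add_zero]⟩
    refine ⟨h4, ?_⟩
    rw [h4, digit_eq, h1]
    exact finrank_inf_ker_add_one _ _ hp (by rw [LinearMap.proj_apply, hpj]; exact one_ne_zero)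

theorem finrank_inf_vanishing_add_rankOn {n : ℕ} (J : List (Fin n)) : ∀ B : List ℕ,
    Module.finrank (ZMod 2) (spanWords n B ⊓ vanishing n J : BinaryCode n) +
      rankOn (J.map Fin.val) B = Module.finrank (ZMod 2) (spanWords n B) := by
  induction J with
  | nil =>
    intro B
    have : vanishing n [] = ⊤ := by
      refine eq_top_iff.2 fun v _ j hj => ?_
      simp at hj
    rw [this, inf_top_eq]
    rfl
  | cons j J ih =>
    intro B
    have h1 : vanishing n (j :: J) =
        LinearMap.ker (LinearMap.proj j : (Fin n → ZMod 2) →ₗ[ZMod 2] ZMod 2) ⊓ vanishing n J := by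
      ext v
      exact List.forall_mem_cons
    obtain ⟨h2, h3⟩ := spanWords_clear j B
    have h4 := ih (clear j (pivot j B) B)
    rw [h1, ← inf_assoc, ← h2, ← h3, ← h4, add_assoc]
    congr 1
    exact add_comm _ _

/-- The support of a word given by a number. -/
def support (n x : ℕ) : List (Fin n) :=
  (List.finRange n).filter fun j => Nat.beq (digit x j) 1

theorem mem_support {n x : ℕ} {j : Fin n} : j ∈ support n x ↔ toWord n x j ≠ 0 := by
  have h : (Nat.beq (digit x j) 1 = true) ↔ x.testBit j = true := by
    rw [digit_eq]
    cases x.testBit j <;> decide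
  rw [support, List.mem_filter, h]
  simp [List.mem_finRange, toWord]

theorem hammingNorm_toWord (n x : ℕ) : hammingNorm (toWord n x) = (support n x).length := by
  have h : (support n x).Nodup := (List.nodup_finRange n).filter _
  rw [← List.toFinset_card_of_nodup h, hammingNorm]
  congr 1
  ext j
  simp [mem_support]

theorem ker_mulLeft_toWord (n x : ℕ) :
    LinearMap.ker (LinearMap.mulLeft (ZMod 2) (toWord n x)) = vanishing n (support n x) := by
  ext v
  rw [LinearMap.mem_ker, LinearMap.mulLeft_apply, funext_iff]
  refine forall_congr' fun j => ?_
  rw [mem_support, Pi.mul_apply, Pi.zero_apply, mul_eq_zero]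
  tauto

theorem toWord_mem_wordsOfType {n x w d : ℕ} {B : List ℕ} :
    toWord n x ∈ wordsOfType (spanWords n B) w d ↔
      toWord n x ∈ spanWords n B ∧ (support n x).length = w ∧
        d + rankOn ((support n x).map Fin.val) B = Module.finrank (ZMod 2) (spanWords n B) := by
  rw [mem_wordsOfType, hammingNorm_toWord, ker_mulLeft_toWord,
    ← finrank_inf_vanishing_add_rankOn (support n x) B, Nat.add_right_cancel_iff, eq_comm (a := d)]

end BinaryCode

namespace BinaryCode

open BitSlice

/-! ### The parity of the invariant for four-circulant codes -/

/-- The rows of the generator matrix as numbers. -/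
def generatorWord (a b a' b' : ℕ) (i : Fin 28 ⊕ Fin 28) : ℕ :=
  Nat.lor (Nat.shiftLeft 1 (pos i)) (Nat.shiftLeft (row a b a' b' i) 56)

theorem testBit_one (k : ℕ) : Nat.testBit 1 k = decide (k = 0) := by
  simpa using Nat.testBit_two_pow_sub_one 1 k

theorem pos_lt (i : Fin 28 ⊕ Fin 28) : pos i < 56 := by
  rcases i with i | i
  · exact i.2.trans (by norm_num)
  · exact Nat.add_lt_add_left i.2 28

theorem pos_injective : Function.Injective pos := by
  rintro (i | i) (j | j) h
  · exact congrArg Sum.inl (Fin.ext h)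
  · have h : (i : ℕ) = 28 + j := h
    omega
  · have h : 28 + (i : ℕ) = j := h
    omega
  · have h : 28 + (i : ℕ) = 28 + j := h
    exact congrArg Sum.inr (Fin.ext (by omega))

theorem toWord_generatorWord {a b a' b' : ℕ} (ha : IsReversal a a') (hb : IsReversal b b')
    (i : Fin 28 ⊕ Fin 28) : toWord 112 (generatorWord a b a' b' i) =
      fun j => fourCirculantGenerator (bits a) (bits b) i ((fourBlockEquiv 28).symm j) := by
  have hword : generatorWord a b a' b' i = (1 <<< pos i) ||| (row a b a' b' i <<< 56) := rfl
  have hif : ∀ c : ZMod 2, (if decide (c = 1) = true then (1 : ZMod 2) else 0) = c := by decide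
  funext j
  obtain ⟨k, rfl⟩ := (fourBlockEquiv 28).surjective j
  rw [Equiv.symm_apply_apply, toWord, hword, Nat.testBit_or, Nat.testBit_shiftLeft,
    Nat.testBit_shiftLeft]
  rcases k with k | k
  · have h1 : ((fourBlockEquiv 28 (Sum.inl k) : Fin 112) : ℕ) = pos k := by
      rcases k with k | k <;> rfl
    have h2 := pos_lt k
    rw [h1, decide_eq_false (Nat.not_le.2 h2 : ¬ pos k ≥ 56), Bool.false_and, Bool.or_false,
      fourCirculantGenerator, Matrix.fromCols_apply_inl, Matrix.one_apply]
    rcases eq_or_ne i k with rfl | h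
    · simp
    · have h3 : pos i ≠ pos k := fun h' => h (pos_injective h')
      rw [if_neg h, if_neg]
      rw [testBit_one, ← Bool.decide_and, decide_eq_true_iff]
      omega
  · have h1 : ((fourBlockEquiv 28 (Sum.inr k) : Fin 112) : ℕ) = 56 + pos k := by
      rcases k with k | k <;> rfl
    have h2 := pos_lt i
    rw [h1, Nat.add_sub_cancel_left, testBit_row ha hb,
      decide_eq_true (Nat.le_add_right 56 (pos k) : 56 + pos k ≥ 56), Bool.true_and,
      testBit_one, decide_eq_false (by omega : ¬ 56 + pos k - pos i = 0), Bool.and_false,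
      Bool.false_or, hif]
    rfl

/-- All row indices. -/
def allRows : List (Fin 28 ⊕ Fin 28) :=
  (List.finRange 28).map Sum.inl ++ (List.finRange 28).map Sum.inr

theorem mem_allRows (i : Fin 28 ⊕ Fin 28) : i ∈ allRows := by
  rcases i with i | i <;> simp [allRows]

theorem sum_allRows {M : Type*} [AddCommMonoid M] (f : Fin 28 ⊕ Fin 28 → M) :
    (allRows.map f).sum = ∑ i, f i := by
  have h1 : (Finset.univ : Finset (Fin 28 ⊕ Fin 28)) = allRows.toFinset := by
    ext i
    simp [mem_allRows]
  have h2 : allRows.Nodup := by decide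
  rw [h1, List.sum_toFinset f h2]

/-- The generators of a four-circulant code as numbers. -/
def generators (a b a' b' : ℕ) : List ℕ := allRows.map (generatorWord a b a' b')

theorem spanWords_generators {a b a' b' : ℕ} (ha : IsReversal a a') (hb : IsReversal b b') :
    spanWords 112 (generators a b a' b') = fourCirculantCode (bits a) (bits b) := by
  rw [spanWords, fourCirculantCode]
  congr 1
  ext v
  constructor
  · rintro ⟨x, hx, rfl⟩
    obtain ⟨i, -, rfl⟩ := List.mem_map.1 hx
    exact ⟨i, (toWord_generatorWord ha hb i).symm⟩
  · rintro ⟨i, rfl⟩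
    exact ⟨_, List.mem_map_of_mem (mem_allRows i), toWord_generatorWord ha hb i⟩

/-- The codeword with a given left half, as a number. -/
def codeword (a b a' b' : ℕ) (c : Fin 28 ⊕ Fin 28 → ZMod 2) : ℕ :=
  allRows.foldr (fun i x => if c i = 1 then Nat.xor (generatorWord a b a' b' i) x else x) 0

theorem toWord_codeword {a b a' b' : ℕ} (ha : IsReversal a a') (hb : IsReversal b b')
    (c : Fin 28 ⊕ Fin 28 → ZMod 2) : toWord 112 (codeword a b a' b' c) =
      glue (m := 28) c (Matrix.vecMul c (rightBlock (bits a) (bits b))) := by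
  rw [← sum_smul_generator, ← sum_allRows, codeword]
  induction allRows with
  | nil => exact toWord_zero _
  | cons i L ih =>
    rw [List.foldr_cons, List.map_cons, List.sum_cons, ← ih]
    rcases (show ∀ c : ZMod 2, c = 0 ∨ c = 1 by decide) (c i) with h | h
    · rw [h, if_neg (by decide), zero_smul, zero_add]
    · rw [h, if_pos rfl, one_smul]
      exact (toWord_xor _ _ _).trans (by rw [toWord_generatorWord ha hb])

theorem eq_of_left_eq {m : ℕ} {a b : Fin m → ZMod 2} {v w : Fin ((m + m) + (m + m)) → ZMod 2}
    (hv : v ∈ fourCirculantCode a b) (hw : w ∈ fourCirculantCode a b) (h : left v = left w) :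
    v = w := by
  refine ext_halves h ?_
  rw [mem_fourCirculantCode.1 hv, mem_fourCirculantCode.1 hw, h]

theorem map_relabel {m : ℕ} {a b : Fin m → ZMod 2} {π : Equiv.Perm (Fin m ⊕ Fin m)}
    (hπ : ∀ i j, rightBlock a b (π i) (π j) = rightBlock a b i j) :
    fourCirculantCode a b =
      (fourCirculantCode a b).map (LinearMap.funLeft (ZMod 2) (ZMod 2) (relabel π)) := by
  symm
  refine Submodule.eq_of_le_of_finrank_eq ?_ ?_
  · rintro _ ⟨v, hv, rfl⟩
    exact comp_relabel_mem hπ hv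
  · exact LinearEquiv.finrank_map_eq (LinearEquiv.funCongrLeft (ZMod 2) (ZMod 2) (relabel π)) _

/-- The residue modulo seven. -/
def residue (i : Fin 28) : Fin 7 := ⟨i % 7, Nat.mod_lt _ (by norm_num)⟩

/-- The left halves that are fixed by the rotation by seven places and by the reflection. -/
def periodic (t : Fin 7 → ZMod 2) : Fin 28 ⊕ Fin 28 → ZMod 2 :=
  Sum.elim (fun i => t (residue i)) (fun i => t (residue (-i)))

theorem periodic_rotation (t : Fin 7 → ZMod 2) (i) : periodic t (rotation 7 i) = periodic t i := by
  rcases i with i | i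
  · exact congrArg t ((by decide : ∀ i : Fin 28, residue (i + 7) = residue i) i)
  · exact congrArg t ((by decide : ∀ i : Fin 28, residue (-(i + 7)) = residue (-i)) i)

theorem periodic_reflection (t : Fin 7 → ZMod 2) (i) :
    periodic t (reflection i) = periodic t i := by
  rcases i with i | i
  · exact congrArg t (congrArg residue (neg_neg i))
  · rfl

/-- Conversely, a left half fixed by the rotation and the reflection is determined by its values at
the first seven coordinates. -/
theorem exists_eq_periodic {c : Fin 28 ⊕ Fin 28 → ZMod 2} (h1 : ∀ i, c (rotation 7 i) = c i)
    (h2 : ∀ i, c (reflection i) = c i) : ∃ t, c = periodic t := by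
  refine ⟨fun k => c (Sum.inl (Fin.castLE (by norm_num) k)), ?_⟩
  have h3 : ∀ i : Fin 28, c (Sum.inl i) = c (Sum.inl (Fin.castLE (by norm_num) (residue i))) := by
    intro i
    have h4 : ∀ j, c (Sum.inl (j + 7)) = c (Sum.inl j) := fun j => h1 (Sum.inl j)
    rcases (by decide : ∀ i : Fin 28,
      let j : Fin 28 := Fin.castLE (Nat.le_of_ble_eq_true rfl) (residue i)
      i = j ∨ i = j + 7 ∨ i = j + 7 + 7 ∨ i = j + 7 + 7 + 7) i with h | h | h | h
    · exact congrArg (fun j => c (Sum.inl j)) h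
    · exact (congrArg (fun j => c (Sum.inl j)) h).trans (h4 _)
    · exact (congrArg (fun j => c (Sum.inl j)) h).trans ((h4 _).trans (h4 _))
    · exact (congrArg (fun j => c (Sum.inl j)) h).trans ((h4 _).trans ((h4 _).trans (h4 _)))
  funext i
  rcases i with i | i
  · exact h3 i
  · exact (h2 (Sum.inr i)).symm.trans (h3 (-i))

/-- The evaluation of membership in `wordsOfType` for the codeword with left half `periodic t`. -/
def hasType (a b a' b' w d : ℕ) (t : Fin 7 → ZMod 2) : Bool :=
  Nat.beq (support 112 (codeword a b a' b' (periodic t))).length w &&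
    Nat.beq (d + rankOn ((support 112 (codeword a b a' b' (periodic t))).map Fin.val)
      (generators a b a' b')) 56

theorem hasType_iff {a b a' b' : ℕ} (ha : IsReversal a a') (hb : IsReversal b b') (w d : ℕ)
    (t : Fin 7 → ZMod 2) : hasType a b a' b' w d t = true ↔
      glue (m := 28) (periodic t) (Matrix.vecMul (periodic t) (rightBlock (bits a) (bits b))) ∈
        wordsOfType (n := 112) (fourCirculantCode (bits a) (bits b)) w d := by
  have h1 : Module.finrank (ZMod 2) (fourCirculantCode (bits a) (bits b) : BinaryCode 112) = 56 :=
    finrank_fourCirculantCode (m := 28) _ _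
  have h2 := toWord_mem_wordsOfType (n := 112) (x := codeword a b a' b' (periodic t)) (w := w)
    (d := d) (B := generators a b a' b')
  rw [spanWords_generators ha hb, h1, toWord_codeword ha hb] at h2
  rw [hasType, Bool.and_eq_true, Nat.beq_eq, Nat.beq_eq]
  exact ⟨fun h => h2.2 ⟨glue_mem _ _ _, h⟩, fun h => (h2.1 h).2⟩

theorem card_wordsOfType_mod_two {a b a' b' : ℕ} (ha : IsReversal a a') (hb : IsReversal b b')
    (w d : ℕ) :
    (wordsOfType (n := 112) (fourCirculantCode (bits a) (bits b)) w d).card % 2 =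
      (Finset.univ.filter fun t => hasType a b a' b' w d t = true).card % 2 := by
  set S := wordsOfType (n := 112) (fourCirculantCode (bits a) (bits b)) w d with hS
  have hmem : ∀ v ∈ S, v ∈ fourCirculantCode (m := 28) (bits a) (bits b) :=
    fun v hv => (mem_wordsOfType.1 hv).1
  have hrot := map_relabel (rightBlock_rotation (bits a) (bits b) 7)
  have href := map_relabel (rightBlock_reflection (bits a) (bits b))
  rw [card_mod_two_eq_card_fixed_dihedral S (relabel (m := 28) (rotation 7))
    (relabel (m := 28) reflection)
    (fun v hv => (comp_mem_wordsOfType hrot).2 hv) (fun v hv => (comp_mem_wordsOfType href).2 hv)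
    (by decide +kernel) (by decide +kernel) (by decide +kernel)]
  congr 1
  symm
  refine Finset.card_bij (fun t _ => glue (m := 28) (periodic t)
    (Matrix.vecMul (periodic t) (rightBlock (bits a) (bits b)))) ?_ ?_ ?_
  · intro t ht
    have h := (hasType_iff ha hb w d t).1 (Finset.mem_filter.1 ht).2
    refine Finset.mem_filter.2 ⟨h, ?_, ?_⟩
    · refine eq_of_left_eq (m := 28) (comp_relabel_mem (rightBlock_rotation _ _ 7) (hmem _ h))
        (hmem _ h) ?_
      rw [left_comp_relabel, left_glue]
      exact funext (periodic_rotation t)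
    · refine eq_of_left_eq (m := 28) (comp_relabel_mem (rightBlock_reflection _ _) (hmem _ h))
        (hmem _ h) ?_
      rw [left_comp_relabel, left_glue]
      exact funext (periodic_reflection t)
  · intro t _ t' _ h
    have h := congrArg (left (m := 28)) h
    rw [left_glue, left_glue] at h
    funext k
    have h1 : ∀ k : Fin 7, residue (Fin.castLE (by norm_num) k) = k := by decide
    have h2 := congrFun h (Sum.inl (Fin.castLE (by norm_num) k))
    change t (residue _) = t' (residue _) at h2
    rwa [h1] at h2
  · intro v hv
    obtain ⟨hv, h1, h2⟩ := Finset.mem_filter.1 hv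
    obtain ⟨t, ht⟩ := exists_eq_periodic (c := left (m := 28) v)
      (fun i => by
        have h := congrArg (left (m := 28)) h1
        rw [left_comp_relabel] at h
        exact congrFun h i)
      (fun i => by
        have h := congrArg (left (m := 28)) h2
        rw [left_comp_relabel] at h
        exact congrFun h i)
    have h3 : glue (m := 28) (periodic t)
        (Matrix.vecMul (periodic t) (rightBlock (bits a) (bits b))) = v := by
      rw [← ht, ← mem_fourCirculantCode.1 (hmem v hv), glue_left_right]
    refine ⟨t, Finset.mem_filter.2 ⟨Finset.mem_univ _, (hasType_iff ha hb w d t).2 ?_⟩, h3⟩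
    rw [h3]
    exact hv

end BinaryCode

namespace BinaryCode

/-! ### Inequivalence -/

theorem IsDoublyEvenData.card_mod_two {a b a' b' : ℕ} (h : IsDoublyEvenData a b a' b') (d : ℕ)
    {k : ℕ} (hk : (Finset.univ.filter fun t => hasType a b a' b' 48 d t = true).card = k) :
    (wordsOfType (n := 112) (fourCirculantCode (bits a) (bits b)) 48 d).card % 2 = k % 2 := by
  rw [card_wordsOfType_mod_two h.reversal_left h.reversal_right, hk]

theorem card_D112_eleven : (wordsOfType D112 48 11).card % 2 = 1 := by
  rw [D112_eq]
  exact isDoublyEvenData_D.card_mod_two 11 (k := 5) (by decide +kernel)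

theorem card_E112_eleven : (wordsOfType E112 48 11).card % 2 = 0 := by
  rw [E112_eq]
  exact isDoublyEvenData_E.card_mod_two 11 (k := 8) (by decide +kernel)

theorem card_D112_fifteen : (wordsOfType D112 48 15).card % 2 = 0 := by
  rw [D112_eq]
  exact isDoublyEvenData_D.card_mod_two 15 (k := 0) (by decide +kernel)

theorem card_E112_fifteen : (wordsOfType E112 48 15).card % 2 = 0 := by
  rw [E112_eq]
  exact isDoublyEvenData_E.card_mod_two 15 (k := 0) (by decide +kernel)

theorem card_H112_fifteen : (wordsOfType H112 48 15).card % 2 = 1 :=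
  isDoublyEvenData_H.card_mod_two 15 (k := 1) (by decide +kernel)

theorem D112_not_equivalent_E112 : ¬ D112.Equivalent E112 := fun h => by
  have h1 := h.card_wordsOfType_eq 48 11
  have h2 := card_D112_eleven
  rw [h1, card_E112_eleven] at h2
  exact absurd h2 (by norm_num)

theorem H112_not_equivalent_D112 : ¬ H112.Equivalent D112 := fun h => by
  have h1 := h.card_wordsOfType_eq 48 15
  have h2 := card_H112_fifteen
  rw [h1, card_D112_fifteen] at h2
  exact absurd h2 (by norm_num)

theorem H112_not_equivalent_E112 : ¬ H112.Equivalent E112 := fun h => by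
  have h1 := h.card_wordsOfType_eq 48 15
  have h2 := card_H112_fifteen
  rw [h1, card_E112_fifteen] at h2
  exact absurd h2 (by norm_num)

end BinaryCode

theorem mainTheorem1 :
    BinaryCode.IsSinglyEvenSelfDual BinaryCode.C112 ∧
    BinaryCode.AreNeighbors BinaryCode.C112 BinaryCode.D112 ∧
    BinaryCode.IsExtremalDoublyEvenSelfDual BinaryCode.D112 ∧
    BinaryCode.IsExtremalDoublyEvenSelfDual BinaryCode.E112 ∧
    ¬ BinaryCode.Equivalent BinaryCode.D112 BinaryCode.E112 ∧
    ∃ H : BinaryCode 112,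
      BinaryCode.IsExtremalDoublyEvenSelfDual H ∧
      ¬ BinaryCode.Equivalent H BinaryCode.D112 ∧
      ¬ BinaryCode.Equivalent H BinaryCode.E112 :=
  ⟨BinaryCode.C112_isSinglyEvenSelfDual, BinaryCode.C112_areNeighbors_D112,
    BinaryCode.D112_isExtremal, BinaryCode.E112_isExtremal, BinaryCode.D112_not_equivalent_E112,
    BinaryCode.H112, BinaryCode.H112_isExtremal, BinaryCode.H112_not_equivalent_D112,
    BinaryCode.H112_not_equivalent_E112⟩
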